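/- For $\omega=\omega_0\omega_1\ldots\in\{0,1,2\}^{\mathbb N}$ let $G_\omega$ be the Grigorchuk group, i.e. the group of automorphisms of the rooted binary tree generated by $a,b_\omega,c_\omega,d_\omega$, where $a$ permutes the two subtrees of the root and $$b_\omega=(\omega_0(b),b_{\mathfrak s\omega}),\quad c_\omega=(\omega_0(c),c_{\mathfrak s\omega}),\quad d_\omega=(\omega_0(d),d_{\mathfrak s\omega}).$$ Here $\mathfrak s$ is the shift, $(g_0,g_1)$ denotes the automorphism that fixes the two children of the root and acts on the subtrees below them by $g_0$ and $g_1$, and the letters $0,1,2$ stand for the three non-trivial homomorphisms from $\mathbb Z/2\mathbb Z\times\mathbb Z/2\mathbb Z=\{id,b,c,d\}$ to $\mathbb Z/2\mathbb Z=\{id,a\}$, with kernels $\{id,d\}$, $\{id,c\}$, $\{id,b\}$ respectively. Let $\Omega'$ be the set of those $\omega$ for which there is $k\in\mathbb N$ such that all three letters $0,1,2$ occur in every block $\omega_{k(i-1)}\ldots\omega_{ki-1}$, $i=1,2,\ldots$ Then $\Omega'$ is uncountable, and for every $\omega\in\Omega'$ every invariant random subgroup of $G_\omega$ is co-sofic.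 That is, every Borel probability measure on the space $\mathrm{Sub}(G_\omega)\subseteq\{0,1\}^{G_\omega}$ of subgroups (with the topology induced by the product topology) that is invariant under conjugation by $G_\omega$ is the weak-$*$ limit of a sequence of conjugation-invariant Borel probability measures that give full measure to the set of subgroups of finite index. -/

import Mathlib

open MeasureTheory Filter Topology

noncomputable section

namespace InvariantRandomSubgroup

/-- The Chabauty topology on the space of subgroups of a discrete group `G`: the topology induced
by the inclusion of the space of subgroups into `{0,1}^G`, where `{0,1}` is discrete and `{0,1}^G`
carries the product topology. (The value `true` at `g` means that `g` belongs to the subgroup.) -/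
instance chabautyTopology (G : Type*) [Group G] : TopologicalSpace (Subgroup G) :=
  TopologicalSpace.induced
    (fun (H : Subgroup G) (g : G) => (open Classical in decide (g ∈ H) : Bool)) inferInstance

/-- The space of subgroups carries its Borel sigma-algebra. -/
instance chabautyMeasurableSpace (G : Type*) [Group G] : MeasurableSpace (Subgroup G) :=
  borel (Subgroup G)

instance chabautyBorelSpace (G : Type*) [Group G] : BorelSpace (Subgroup G) := ⟨rfl⟩

/-- A Borel probability measure on the space of subgroups of a discrete group `G` is an invariant
random subgroup (IRS) if it is invariant under conjugation `H ↦ g H g⁻¹` by every `g : G`. -/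
def IsIRS {G : Type*} [Group G] (μ : ProbabilityMeasure (Subgroup G)) : Prop :=
  ∀ g : G, MeasurePreserving (fun H : Subgroup G => H.map (MulAut.conj g).toMonoidHom)
    (μ : Measure (Subgroup G)) (μ : Measure (Subgroup G))

/-- A measure on the space of subgroups of a countable discrete group `G` is co-sofic if it is a
weak-* limit of IRSs supported on finite index subgroups. (The topology on `ProbabilityMeasure` is
that of weak convergence against bounded continuous functions. The space of subgroups of a
countable group is compact and metrizable, so that sequences suffice.) -/
def IsCosofic {G : Type*} [Group G] (μ : ProbabilityMeasure (Subgroup G)) : Prop :=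
  ∃ ν : ℕ → ProbabilityMeasure (Subgroup G),
    (∀ n, IsIRS (ν n) ∧ ∀ᵐ H ∂(ν n : Measure (Subgroup G)), H.FiniteIndex) ∧
    Tendsto ν atTop (𝓝 μ)

end InvariantRandomSubgroup

namespace GrigorchukFamily

/-- The Klein four-group `ℤ/2ℤ × ℤ/2ℤ = {id, b, c, d}`, written additively. -/
abbrev Klein : Type := ZMod 2 × ZMod 2

/-- The element `b` of the Klein four-group. -/
def kb : Klein := (0, 1)

/-- The element `c` of the Klein four-group. -/
def kc : Klein := (1, 0)

/-- The element `d = b c` of the Klein four-group. -/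
def kd : Klein := (1, 1)

/-- The three non-trivial homomorphisms from the Klein four-group to `ℤ/2ℤ`, labelled `0, 1, 2`:
the kernel of `0` is `{id, d}`, the kernel of `1` is `{id, c}`, the kernel of `2` is `{id, b}`. -/
def letterHom : Fin 3 → (Klein →+ ZMod 2) :=
  ![AddMonoidHom.fst _ _ + AddMonoidHom.snd _ _, AddMonoidHom.snd _ _, AddMonoidHom.fst _ _]

/-- The root permutation of the rooted binary tree, whose vertices are the finite words in two
letters: it permutes the two subtrees of the root. -/
def swapFun : List Bool → List Bool
  | [] => []
  | x :: v => (!x) :: v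

/-- The shift on sequences. -/
def shift (ω : ℕ → Fin 3) : ℕ → Fin 3 := fun n => ω (n + 1)

/-- The action on the vertices of the rooted binary tree of the element
`x_ω = (ω₀(x), x_{𝔰ω})`, where `x` is in the Klein four-group and `𝔰` is the shift. It preserves
the two subtrees of the root; its section at the first one is `a` or the identity according to
whether `ω₀(x)` is non-trivial or trivial, and its section at the second one is `x_{𝔰ω}`. -/
def directedFun (x : Klein) : (ℕ → Fin 3) → List Bool → List Bool
  | _, [] => []
  | ω, false :: v => false :: (if letterHom (ω 0) x = 0 then v else swapFun v)
  | ω, true :: v => true :: directedFun x (shift ω) v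

theorem swapFun_involutive : Function.Involutive swapFun := by
  intro v
  cases v <;> simp [swapFun]

theorem directedFun_involutive (x : Klein) (ω : ℕ → Fin 3) :
    Function.Involutive (directedFun x ω) := by
  intro v
  induction v generalizing ω with
  | nil => rfl
  | cons y v ih =>
    cases y
    · by_cases h : letterHom (ω 0) x = 0
      · simp [directedFun, h]
      · simp [directedFun, h, swapFun_involutive v]
    · simp [directedFun, ih]

/-- The generator `a`, as a permutation of the vertices of the rooted binary tree. -/
def genA : Equiv.Perm (List Bool) := swapFun_involutive.toPerm

/-- The element `x_ω`, as a permutation of the vertices of the rooted binary tree. -/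
def directed (x : Klein) (ω : ℕ → Fin 3) : Equiv.Perm (List Bool) :=
  (directedFun_involutive x ω).toPerm

/-- The Grigorchuk group `G_ω`, generated by `a, b_ω, c_ω, d_ω`. These generators, and so all
elements of the group, are automorphisms of the rooted binary tree. -/
def grigorchukGroup (ω : ℕ → Fin 3) : Subgroup (Equiv.Perm (List Bool)) :=
  Subgroup.closure {genA, directed kb ω, directed kc ω, directed kd ω}

/-- The set of sequences `ω` for which there is `k` such that all three letters occur in every
block `ω_{ki} … ω_{ki+k-1}`, `i = 0, 1, 2, …`. -/
def blockSequences : Set (ℕ → Fin 3) :=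
  {ω | ∃ k : ℕ, ∀ i : ℕ, ∀ x : Fin 3, ∃ j < k, ω (k * i + j) = x}

end GrigorchukFamily

end

/-! The only property of `blockSequences` that matters is that every letter occurs infinitely often
(`EveryLetterOften`). For a subgroup H of G_ω, call a vertex live if H fixes a boundary point below
it. The approximation `levelApprox n H` is the product of two commuting groups: the elements of H
that are trivial below the live vertices of level n, and the elements of G_ω that fix level n and
are trivial below its other vertices. It depends measurably and equivariantly on H, so by
`IsIRS.isCosofic_of_tendsto` it suffices that almost surely it has finite index and tends to H.

Finite index. If g ∈ H moves u and L is the rigid stabilizer of u, then L commutes with gLg⁻¹, and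
invariance forces H ∩ (L × gLg⁻¹) to project onto a finite index subgroup of L
(`IsIRS.ae_relIndex_projSubgroup_ne_zero`). A deeper vertex is moved by two elements of H to two
different places. In commutators of lifts the auxiliary factors cancel, so H contains the derived
subgroup of a finite index subgroup of a copy of some G_{𝔰ⁿω}
(`HasLargeProjections.exists_relIndex_ne_zero`). That derived subgroup has finite index, as these
groups are finitely generated and torsion (`isOfFinOrder_of_mem`).

Convergence. The obstruction is an element g that fixes the live vertices but acts non-trivially
below live vertices of arbitrarily deep levels. Sections contract to the generators, so g has the
germ of a generator b, c or d along a ray v111… of live vertices. Then g swaps the two children of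
v1ʲ0 for infinitely many j, so that these vertices are not live although v1ʲ is. The probability of
being live depends only on the level and decreases to a limit, so this event is null
(`ae_exists_not_live`). -/

namespace GrigorchukFamily

/-! ### Sections, transitivity on levels, and tree automorphisms -/

/-- The map acting by `f` on the words that start with `b`, below their first letter. -/
def childFun (b : Bool) (f : List Bool → List Bool) : List Bool → List Bool
  | [] => []
  | c :: v => if c = b then c :: f v else c :: v

theorem childFun_comp (b : Bool) (f g : List Bool → List Bool) (v : List Bool) :
    childFun b f (childFun b g v) = childFun b (f ∘ g) v := by
  cases v with
  | nil => rfl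
  | cons c v => by_cases h : c = b <;> simp [childFun, h]

theorem childFun_id (b : Bool) (v : List Bool) : childFun b id v = v := by
  cases v <;> simp [childFun]

/-- The embedding of permutations as permutations acting below the child `b` of the root. -/
def child (b : Bool) : Equiv.Perm (List Bool) →* Equiv.Perm (List Bool) where
  toFun g :=
    { toFun := childFun b g
      invFun := childFun b g.symm
      left_inv := fun v => by rw [childFun_comp, g.symm_comp_self, childFun_id]
      right_inv := fun v => by rw [childFun_comp, g.self_comp_symm, childFun_id] }
  map_one' := Equiv.ext (childFun_id b)
  map_mul' g h := Equiv.ext fun v => (childFun_comp b g h v).symm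

@[simp] theorem child_nil (b : Bool) (g : Equiv.Perm (List Bool)) : child b g [] = [] := rfl

@[simp] theorem child_cons_self (b : Bool) (g : Equiv.Perm (List Bool)) (v : List Bool) :
    child b g (b :: v) = b :: g v := by
  change childFun b g (b :: v) = _
  simp [childFun]

theorem child_cons_of_ne {b c : Bool} (h : c ≠ b) (g : Equiv.Perm (List Bool)) (v : List Bool) :
    child b g (c :: v) = c :: v := by
  change childFun b g (c :: v) = _
  simp [childFun, h]

@[simp] theorem child_false_cons_true (g : Equiv.Perm (List Bool)) (v : List Bool) :
    child false g (true :: v) = true :: v := child_cons_of_ne (by simp) g v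

@[simp] theorem child_true_cons_false (g : Equiv.Perm (List Bool)) (v : List Bool) :
    child true g (false :: v) = false :: v := child_cons_of_ne (by simp) g v

theorem child_commute (g h : Equiv.Perm (List Bool)) :
    Commute (child false g) (child true h) := by
  ext1 v
  rcases v with _ | ⟨_ | _, v⟩ <;> simp

@[simp] theorem genA_nil : genA [] = [] := rfl

@[simp] theorem genA_cons (b : Bool) (v : List Bool) : genA (b :: v) = (!b) :: v := rfl

@[simp] theorem genA_mul_genA : genA * genA = 1 := by
  ext1 v
  cases v <;> simp

@[simp] theorem genA_inv : genA⁻¹ = genA := inv_eq_of_mul_eq_one_left genA_mul_genA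

theorem genA_mul_child (b : Bool) (g : Equiv.Perm (List Bool)) :
    genA * child b g = child (!b) g * genA := by
  ext1 v
  rcases v with _ | ⟨_ | _, v⟩ <;> cases b <;> simp

@[simp] theorem directed_nil (x : Klein) (ω : ℕ → Fin 3) : directed x ω [] = [] := rfl

/-- The element `a` or the identity, according to an exponent in `ℤ/2ℤ`. -/
def powA (e : ZMod 2) : Equiv.Perm (List Bool) := if e = 0 then 1 else genA

@[simp] theorem powA_zero : powA 0 = 1 := by simp [powA]

theorem powA_of_ne {e : ZMod 2} (h : e ≠ 0) : powA e = genA := by simp [powA, h]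

theorem powA_add (e f : ZMod 2) : powA (e + f) = powA e * powA f := by
  have h : ∀ e : ZMod 2, e = 0 ∨ e = 1 := by decide
  have h2 : (1 + 1 : ZMod 2) = 0 := rfl
  rcases h e with rfl | rfl <;> rcases h f with rfl | rfl <;> simp [powA, h2]

@[simp] theorem directed_cons_false (x : Klein) (ω : ℕ → Fin 3) (v : List Bool) :
    directed x ω (false :: v) = false :: powA (letterHom (ω 0) x) v := by
  change directedFun x ω (false :: v) = _
  rw [directedFun, powA]
  split_ifs <;> rfl

@[simp] theorem directed_cons_true (x : Klein) (ω : ℕ → Fin 3) (v : List Bool) :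
    directed x ω (true :: v) = true :: directed x (shift ω) v := rfl

theorem directed_eq (x : Klein) (ω : ℕ → Fin 3) : directed x ω =
    child false (powA (letterHom (ω 0) x)) * child true (directed x (shift ω)) := by
  ext1 v
  rcases v with _ | ⟨_ | _, v⟩ <;> simp

theorem directed_add (x y : Klein) (ω : ℕ → Fin 3) :
    directed (x + y) ω = directed x ω * directed y ω := by
  ext1 v
  induction v generalizing ω with
  | nil => rfl
  | cons b v ih => cases b <;> simp [powA_add, ih]

@[simp] theorem directed_zero (ω : ℕ → Fin 3) : directed 0 ω = 1 := by
  have := directed_add 0 0 ω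
  simpa using this

theorem klein_add_self (x : Klein) : x + x = 0 := by
  revert x; decide

theorem directed_mul_self (x : Klein) (ω : ℕ → Fin 3) : directed x ω * directed x ω = 1 := by
  rw [← directed_add, klein_add_self, directed_zero]

theorem directed_inv (x : Klein) (ω : ℕ → Fin 3) : (directed x ω)⁻¹ = directed x ω :=
  inv_eq_of_mul_eq_one_left (directed_mul_self x ω)

theorem klein_cases (x : Klein) : x = 0 ∨ x = kb ∨ x = kc ∨ x = kd := by
  revert x; decide

theorem genA_mem (ω : ℕ → Fin 3) : genA ∈ grigorchukGroup ω :=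
  Subgroup.subset_closure (by simp)

theorem powA_mem (e : ZMod 2) (ω : ℕ → Fin 3) : powA e ∈ grigorchukGroup ω := by
  unfold powA
  split_ifs
  exacts [one_mem _, genA_mem ω]

theorem directed_mem (x : Klein) (ω : ℕ → Fin 3) : directed x ω ∈ grigorchukGroup ω := by
  rcases klein_cases x with rfl | rfl | rfl | rfl
  · rw [directed_zero]
    exact one_mem _
  all_goals exact Subgroup.subset_closure (by simp)

/-- Induction over the elements of `G_ω`, as words in the generators. -/
theorem grigorchukGroup_induction {ω : ℕ → Fin 3}
    {p : (g : Equiv.Perm (List Bool)) → g ∈ grigorchukGroup ω → Prop}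
    (one : p 1 (one_mem _))
    (genA_mul : ∀ g (hg : g ∈ grigorchukGroup ω), p g hg → p (genA * g) (mul_mem (genA_mem ω) hg))
    (directed_mul : ∀ x, ∀ g (hg : g ∈ grigorchukGroup ω), p g hg →
      p (directed x ω * g) (mul_mem (directed_mem x ω) hg))
    {g : Equiv.Perm (List Bool)} (hg : g ∈ grigorchukGroup ω) : p g hg := by
  suffices ∃ h, p g h from this.2
  induction hg using Subgroup.closure_induction_left with
  | one => exact ⟨_, one⟩
  | mul_left x hx y hy ih =>
    rcases hx with rfl | rfl | rfl | rfl
    exacts [⟨_, genA_mul _ hy ih.2⟩, ⟨_, directed_mul _ _ hy ih.2⟩, ⟨_, directed_mul _ _ hy ih.2⟩,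
      ⟨_, directed_mul _ _ hy ih.2⟩]
  | inv_mul_cancel x hx y hy ih =>
    rcases hx with rfl | rfl | rfl | rfl
    · rw [genA_inv]
      exact ⟨_, genA_mul _ hy ih.2⟩
    all_goals
      rw [directed_inv]
      exact ⟨_, directed_mul _ _ hy ih.2⟩

/-- An element of `G_ω` is a pair of elements of `G_{𝔰ω}` followed by a power of `a`. -/
theorem exists_sections {ω : ℕ → Fin 3} {g : Equiv.Perm (List Bool)}
    (hg : g ∈ grigorchukGroup ω) :
    ∃ g₀ ∈ grigorchukGroup (shift ω), ∃ g₁ ∈ grigorchukGroup (shift ω), ∃ e : ZMod 2,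
      g = child false g₀ * child true g₁ * powA e := by
  induction hg using grigorchukGroup_induction with
  | one => exact ⟨1, one_mem _, 1, one_mem _, 0, by simp⟩
  | genA_mul g _ ih =>
    obtain ⟨g₀, h₀, g₁, h₁, e, rfl⟩ := ih
    refine ⟨g₁, h₁, g₀, h₀, 1 + e, ?_⟩
    rw [powA_add, powA_of_ne one_ne_zero, ← mul_assoc, ← mul_assoc, genA_mul_child,
      mul_assoc _ genA, genA_mul_child, Bool.not_false, Bool.not_true, ← mul_assoc,
      (child_commute g₁ g₀).eq]
    simp only [mul_assoc]
  | directed_mul x g _ ih =>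
    obtain ⟨g₀, h₀, g₁, h₁, e, rfl⟩ := ih
    refine ⟨_, mul_mem (powA_mem (letterHom (ω 0) x) _) h₀, _,
      mul_mem (directed_mem x _) h₁, e, ?_⟩
    rw [directed_eq, map_mul, map_mul]
    simp only [mul_assoc]
    rw [← mul_assoc (child true _) (child false _), ← (child_commute g₀ _).eq]
    simp only [mul_assoc]

theorem exists_letterHom_ne (i : Fin 3) : ∃ x, letterHom i x ≠ 0 := by
  fin_cases i
  exacts [⟨kb, by decide⟩, ⟨kb, by decide⟩, ⟨kc, by decide⟩]

/-- The stabilizer of the second child of the root surjects onto `G_{𝔰ω}`. -/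
theorem exists_lift {ω : ℕ → Fin 3} {g : Equiv.Perm (List Bool)}
    (hg : g ∈ grigorchukGroup (shift ω)) :
    ∃ h ∈ grigorchukGroup ω, ∀ v, h (true :: v) = true :: g v := by
  induction hg using grigorchukGroup_induction with
  | one => exact ⟨1, one_mem _, by simp⟩
  | genA_mul g _ ih =>
    obtain ⟨h, hh, H⟩ := ih
    -- A letter x with ω₀(x) ≠ 0 has section a at the first child; conjugating by a moves this
    -- section to the second child.
    obtain ⟨x, hx⟩ := exists_letterHom_ne (ω 0)
    refine ⟨genA * directed x ω * genA * h, mul_mem (mul_mem (mul_mem (genA_mem ω)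
      (directed_mem x ω)) (genA_mem ω)) hh, fun v => ?_⟩
    simp [H, powA_of_ne hx]
  | directed_mul x g _ ih =>
    obtain ⟨h, hh, H⟩ := ih
    exact ⟨directed x ω * h, mul_mem (directed_mem x ω) hh, by simp [H]⟩

/-- `G_ω` acts transitively on the levels of the tree. -/
theorem exists_apply_eq (ω : ℕ → Fin 3) {u v : List Bool} (h : u.length = v.length) :
    ∃ g ∈ grigorchukGroup ω, g u = v := by
  induction u generalizing ω v with
  | nil =>
    obtain rfl := List.length_eq_zero_iff.1 h.symm
    exact ⟨1, one_mem _, rfl⟩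
  | cons b u ih =>
    rcases v with _ | ⟨c, v⟩
    · simp at h
    obtain ⟨g, hg, rfl⟩ := ih (shift ω) (by simpa using h : u.length = v.length)
    obtain ⟨k, hk, H⟩ := exists_lift hg
    have key : ∀ b : Bool, ∃ e : ZMod 2, ∀ w, powA e (b :: w) = true :: w := by
      rintro (_ | _)
      exacts [⟨1, fun w => by simp [powA]⟩, ⟨0, fun w => by simp⟩]
    obtain ⟨e, he⟩ := key b
    obtain ⟨f, hf⟩ := key c
    refine ⟨(powA f)⁻¹ * k * powA e, mul_mem (mul_mem (inv_mem (powA_mem _ _)) hk)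
      (powA_mem _ _), ?_⟩
    rw [Equiv.Perm.mul_apply, Equiv.Perm.mul_apply, he, H, ← hf]
    exact Equiv.symm_apply_apply _ _

/-- The elements that preserve lengths and prefixes, that is the automorphisms of the tree. -/
def treeAut : Subgroup (Equiv.Perm (List Bool)) where
  carrier := {g | ∀ u v, (g u).length = u.length ∧ (g u <+: g v ↔ u <+: v)}
  one_mem' := by simp
  mul_mem' := fun {g h} hg hh u v => by
    simp [(hg _ (h v)).1, (hg (h u) (h v)).2, hh u v]
  inv_mem' := fun {g} hg u v => by
    have := hg (g⁻¹ u) (g⁻¹ v)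
    have key : ∀ u, g (g⁻¹ u) = u := g.apply_symm_apply
    rw [key, key] at this
    exact ⟨this.1.symm, this.2.symm⟩

theorem genA_mem_treeAut : genA ∈ treeAut := by
  intro u v
  rcases u with _ | ⟨b, u⟩ <;> rcases v with _ | ⟨c, v⟩ <;> simp [List.cons_prefix_cons]

theorem directed_mem_treeAut (x : Klein) (ω : ℕ → Fin 3) : directed x ω ∈ treeAut := by
  intro u v
  induction u generalizing ω v with
  | nil => simp
  | cons b u ih =>
    have hA' : ∀ e, powA e ∈ treeAut := fun e => by
      unfold powA
      split_ifs
      exacts [one_mem _, genA_mem_treeAut]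
    rcases v with _ | ⟨c, v⟩
    · cases b
      · simp [(hA' _ u u).1]
      · simp [(ih _ u).1]
    · cases b <;> cases c <;> simp [(hA' _ u v).1, (hA' _ u v).2, ih _ v, List.cons_prefix_cons]

theorem grigorchukGroup_le_treeAut (ω : ℕ → Fin 3) : grigorchukGroup ω ≤ treeAut := by
  refine (Subgroup.closure_le _).2 ?_
  rintro g (rfl | rfl | rfl | rfl)
  exacts [genA_mem_treeAut, directed_mem_treeAut _ _, directed_mem_treeAut _ _,
    directed_mem_treeAut _ _]

theorem length_apply {g : Equiv.Perm (List Bool)} (hg : g ∈ treeAut) (u : List Bool) :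
    (g u).length = u.length := (hg u u).1

theorem prefix_apply_iff {g : Equiv.Perm (List Bool)} (hg : g ∈ treeAut) {u v : List Bool} :
    g u <+: g v ↔ u <+: v := (hg u v).2

/-- The embedding of permutations as permutations acting below the vertex `u`. -/
def cone : List Bool → (Equiv.Perm (List Bool) →* Equiv.Perm (List Bool))
  | [] => MonoidHom.id _
  | b :: u => (child b).comp (cone u)

theorem cone_apply_append (u : List Bool) (g : Equiv.Perm (List Bool)) (w : List Bool) :
    cone u g (u ++ w) = u ++ g w := by
  induction u with
  | nil => rfl
  | cons b u ih => simp [cone, ih]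

theorem cone_apply_of_not_prefix {u z : List Bool} (h : ¬ u <+: z)
    (g : Equiv.Perm (List Bool)) : cone u g z = z := by
  induction u generalizing z with
  | nil => simp at h
  | cons b u ih =>
    rcases z with _ | ⟨c, z⟩
    · rfl
    by_cases hc : c = b
    · subst hc
      rw [List.cons_prefix_cons] at h
      simp [cone, ih (by simpa using h)]
    · simp [cone, child_cons_of_ne hc]

end GrigorchukFamily

/-! ### Words in the generators, and torsion -/

namespace GrigorchukFamily

/-- The element of `G_ω` that is spelled by a list of pairs of a letter and a power of `a`. -/
def wordProd (ω : ℕ → Fin 3) (l : List (Klein × ZMod 2)) : Equiv.Perm (List Bool) :=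
  (l.map fun p => directed p.1 ω * powA p.2).prod

/-- The product of the elements `x_ω a` for the letters `x` of a list. -/
def altProd (ω : ℕ → Fin 3) (l : List Klein) : Equiv.Perm (List Bool) :=
  (l.map fun x => directed x ω * genA).prod

@[simp] theorem wordProd_nil (ω : ℕ → Fin 3) : wordProd ω [] = 1 := rfl

@[simp] theorem wordProd_cons (ω : ℕ → Fin 3) (p : Klein × ZMod 2) (l : List (Klein × ZMod 2)) :
    wordProd ω (p :: l) = directed p.1 ω * powA p.2 * wordProd ω l := by simp [wordProd]

theorem wordProd_append (ω : ℕ → Fin 3) (l m : List (Klein × ZMod 2)) :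
    wordProd ω (l ++ m) = wordProd ω l * wordProd ω m := by simp [wordProd]

@[simp] theorem altProd_nil (ω : ℕ → Fin 3) : altProd ω [] = 1 := rfl

@[simp] theorem altProd_cons (ω : ℕ → Fin 3) (x : Klein) (l : List Klein) :
    altProd ω (x :: l) = directed x ω * genA * altProd ω l := by simp [altProd]

/-- The number of letters `a` in a word. -/
def countA (l : List (Klein × ZMod 2)) : ℕ := l.countP fun p => p.2 ≠ 0

/-- Neighbouring Klein letters with no a between them merge by addition, so the number of letters a
and the sum of the Klein letters survive. Both invariants drive the torsion argument. -/
theorem wordProd_eq_altProd_mul (ω : ℕ → Fin 3) (l : List (Klein × ZMod 2)) :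
    ∃ l' x, wordProd ω l = altProd ω l' * directed x ω ∧ l'.length = countA l ∧
      l'.sum + x = (l.map Prod.fst).sum := by
  induction l with
  | nil => exact ⟨[], 0, by simp, rfl, rfl⟩
  | cons p l ih =>
    obtain ⟨x, e⟩ := p
    obtain ⟨l', y, h₁, h₂, h₃⟩ := ih
    by_cases he : e = 0
    · subst he
      rcases l' with _ | ⟨z, l'⟩
      · refine ⟨[], x + y, ?_, ?_, ?_⟩
        · simp [h₁, directed_add]
        · simpa [countA] using h₂
        · simp at h₃
          simp [h₃]
      · refine ⟨(x + z) :: l', y, ?_, ?_, ?_⟩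
        · simp [h₁, directed_add, mul_assoc]
        · simpa [countA] using h₂
        · simp at h₃
          simp [← h₃, add_assoc]
    · refine ⟨x :: l', y, ?_, ?_, ?_⟩
      · simp [h₁, powA_of_ne he, mul_assoc]
      · simp [countA, he] at h₂ ⊢
        exact h₂
      · simp [← h₃, add_assoc]

theorem isOfFinOrder_mul_comm {G : Type*} [Group G] {g h : G} (H : IsOfFinOrder (g * h)) :
    IsOfFinOrder (h * g) := by
  have := (MulAut.conj h).toMonoidHom.isOfFinOrder H
  simpa [mul_assoc] using this

theorem isOfFinOrder_directed (x : Klein) (ω : ℕ → Fin 3) : IsOfFinOrder (directed x ω) :=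
  isOfFinOrder_iff_pow_eq_one.2 ⟨2, by norm_num, by rw [pow_two, directed_mul_self]⟩

/-- Conjugation moves the trailing Klein letter of the normal form to the front, where it merges
with the first letter. -/
theorem isOfFinOrder_wordProd {ω : ℕ → Fin 3} {l : List (Klein × ZMod 2)}
    (h : ∀ l' : List Klein, l'.length = countA l → l'.sum = (l.map Prod.fst).sum →
      IsOfFinOrder (altProd ω l')) : IsOfFinOrder (wordProd ω l) := by
  obtain ⟨l', x, h₁, h₂, h₃⟩ := wordProd_eq_altProd_mul ω l
  rw [h₁]
  rcases l' with _ | ⟨z, l'⟩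
  · simpa using isOfFinOrder_directed x ω
  · refine isOfFinOrder_mul_comm ?_
    have := h ((x + z) :: l') (by simpa using h₂) (by
      rw [← h₃, List.sum_cons, List.sum_cons]
      abel)
    simpa [directed_add, mul_assoc] using this

/-- The words that spell the two sections of `altProd ω l`. -/
def sectionWord (ω : ℕ → Fin 3) : Bool → List Klein → List (Klein × ZMod 2)
  | _, [] => []
  | false, x :: l => (0, letterHom (ω 0) x) :: sectionWord ω true l
  | true, x :: l => (x, 0) :: sectionWord ω false l

/-- Each a exchanges the two coordinates, so successive letters contribute x and ω₀(x) to a given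
section in turn. -/
theorem altProd_eq (ω : ℕ → Fin 3) (l : List Klein) : altProd ω l =
    child false (wordProd (shift ω) (sectionWord ω false l)) *
      child true (wordProd (shift ω) (sectionWord ω true l)) * powA l.length := by
  induction l with
  | nil => simp [sectionWord]
  | cons x l ih =>
    rw [altProd_cons, ih, directed_eq, List.length_cons, Nat.cast_succ, add_comm _ (1 : ZMod 2),
      powA_add, powA_of_ne one_ne_zero, sectionWord, sectionWord]
    simp only [wordProd_cons, map_mul, directed_zero, powA_zero, one_mul, mul_one]
    ext1 v
    rcases v with _ | ⟨_ | _, v⟩ <;> generalize powA (l.length : ZMod 2) = A <;> simp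
    all_goals generalize A _ = w; rcases w with _ | ⟨_ | _, w⟩ <;> simp

theorem countA_sectionWord_add (ω : ℕ → Fin 3) (l : List Klein) :
    countA (sectionWord ω false l) + countA (sectionWord ω true l) =
      l.countP fun x => letterHom (ω 0) x ≠ 0 := by
  induction l with
  | nil => rfl
  | cons x l ih =>
    by_cases h : letterHom (ω 0) x = 0 <;> simp [countA, sectionWord, h] at ih ⊢ <;> omega

theorem countA_sectionWord_le (ω : ℕ → Fin 3) (l : List Klein) :
    countA (sectionWord ω false l) ≤ (l.length + 1) / 2 ∧
      countA (sectionWord ω true l) ≤ l.length / 2 := by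
  induction l with
  | nil => simp [countA, sectionWord]
  | cons x l ih =>
    by_cases h : letterHom (ω 0) x = 0 <;> simp [countA, sectionWord, h] at ih ⊢ <;> omega

/-- Each letter survives as a Klein letter in exactly one of the two sections. Hence the sum is
unchanged along the descent for words of odd length. -/
theorem sum_sectionWord (ω : ℕ → Fin 3) (l : List Klein) :
    ((sectionWord ω true l ++ sectionWord ω false l).map Prod.fst).sum = l.sum := by
  induction l with
  | nil => rfl
  | cons x l ih =>
    simp [sectionWord] at ih ⊢
    rw [← ih, add_comm (List.sum _)]

theorem letterHom_sum (i : Fin 3) (l : List Klein) :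
    letterHom i l.sum = ((l.countP fun x => letterHom i x ≠ 0 : ℕ) : ZMod 2) := by
  induction l with
  | nil => simp
  | cons x l ih =>
    have h2 : ∀ e : ZMod 2, e ≠ 0 → e = 1 := by decide
    by_cases h : letterHom i x = 0
    · simp only [List.sum_cons, map_add, ih, h, zero_add]
      simp [h]
    · simp only [List.sum_cons, map_add, ih, h2 _ h]
      simp [h, add_comm]

/-- Every letter occurs infinitely often in `ω`. -/
def EveryLetterOften (ω : ℕ → Fin 3) : Prop := ∀ i N, ∃ n ≥ N, ω n = i

theorem EveryLetterOften.shift {ω : ℕ → Fin 3} (h : EveryLetterOften ω) :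
    EveryLetterOften (shift ω) := fun i N => by
  obtain ⟨n, hn, h⟩ := h i (N + 1)
  exact ⟨n - 1, by omega, by simp [GrigorchukFamily.shift, show n - 1 + 1 = n by omega, h]⟩

theorem EveryLetterOften.iterate {ω : ℕ → Fin 3} (h : EveryLetterOften ω) (n : ℕ) :
    EveryLetterOften (GrigorchukFamily.shift^[n] ω) := by
  induction n generalizing ω with
  | zero => exact h
  | succ n ih => exact ih h.shift

theorem exists_letterHom_eq_zero (x : Klein) : ∃ i, letterHom i x = 0 := by
  rcases klein_cases x with rfl | rfl | rfl | rfl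
  exacts [⟨0, by decide⟩, ⟨2, by decide⟩, ⟨1, by decide⟩, ⟨0, by decide⟩]

theorem isOfFinOrder_child {g h : Equiv.Perm (List Bool)} (hg : IsOfFinOrder g)
    (hh : IsOfFinOrder h) : IsOfFinOrder (child false g * child true h) :=
  (child_commute g h).isOfFinOrder_mul ((child false).isOfFinOrder hg)
    ((child true).isOfFinOrder hh)

theorem countA_append (l m : List (Klein × ZMod 2)) : countA (l ++ m) = countA l + countA m :=
  List.countP_append

/-- The square of (g, h)a is (gh, hg), and its coordinates are conjugate. -/
theorem isOfFinOrder_altProd_of_odd {ω : ℕ → Fin 3} {l : List Klein} (hl : Odd l.length)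
    (h : IsOfFinOrder (wordProd (shift ω) (sectionWord ω true l ++ sectionWord ω false l))) :
    IsOfFinOrder (altProd ω l) := by
  rw [wordProd_append] at h
  have hA : powA ((l.length : ℕ) : ZMod 2) = genA := by
    rw [(ZMod.natCast_eq_one_iff_odd).2 hl, powA_of_ne one_ne_zero]
  have key : ∀ g h : Equiv.Perm (List Bool), (child false g * child true h * genA) ^ 2 =
      child false (g * h) * child true (h * g) := by
    intro g h
    ext1 v
    rcases v with _ | ⟨_ | _, v⟩ <;> simp [pow_two]
  refine IsOfFinOrder.of_pow (n := 2) ?_ two_ne_zero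
  rw [altProd_eq, hA, key]
  exact isOfFinOrder_child (isOfFinOrder_mul_comm h) h

/-- Strong induction on the length. In even length both sections have at most half as many letters
a. In odd length one passes to the product of the two sections, whose number of letters a is the
number of x in the word with ω₀(x) ≠ 0. If ω₀ kills the sum of the letters, this number is even and
so smaller than the odd length. Otherwise the length may stay the same, but the sum is preserved and
ω is shifted, and some later ω_j kills the sum; hence the inner induction on j. -/
theorem isOfFinOrder_altProd {ω : ℕ → Fin 3} (hω : EveryLetterOften ω) (l : List Klein) :
    IsOfFinOrder (altProd ω l) := by
  obtain ⟨k, hk⟩ : ∃ k, l.length = k := ⟨_, rfl⟩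
  induction k using Nat.strong_induction_on generalizing ω l with
  | _ k ih =>
    rcases Nat.even_or_odd k with he | ho
    · rcases l with _ | ⟨x, l⟩
      · simp
      have hA : powA (((x :: l).length : ℕ) : ZMod 2) = 1 := by
        rw [hk, (ZMod.natCast_eq_zero_iff_even).2 he, powA_zero]
      have hlt := countA_sectionWord_le ω (x :: l)
      have hpos : 2 ≤ k := by
        obtain ⟨m, rfl⟩ := he
        simp at hk
        omega
      rw [altProd_eq, hA, mul_one]
      refine isOfFinOrder_child ?_ ?_
      · exact isOfFinOrder_wordProd fun l' h _ => ih _ (by omega) hω.shift l' h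
      · exact isOfFinOrder_wordProd fun l' h _ => ih _ (by omega) hω.shift l' h
    · obtain ⟨j, hj⟩ : ∃ j, letterHom (ω j) l.sum = 0 := by
        obtain ⟨i, hi⟩ := exists_letterHom_eq_zero l.sum
        obtain ⟨j, -, rfl⟩ := hω i 0
        exact ⟨j, hi⟩
      have hc := countA_sectionWord_add ω l
      have hle : (l.countP fun x => letterHom (ω 0) x ≠ 0) ≤ l.length := List.countP_le_length
      induction j generalizing ω l with
      | zero =>
        rw [letterHom_sum, ZMod.natCast_eq_zero_iff_even] at hj
        refine isOfFinOrder_altProd_of_odd (hk ▸ ho) (isOfFinOrder_wordProd fun l' h _ =>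
          ih _ ?_ hω.shift l' h)
        rw [countA_append, add_comm, hc]
        refine lt_of_le_of_ne (hle.trans_eq hk) fun h => ?_
        rw [h] at hj
        exact Nat.not_even_iff_odd.2 ho hj
      | succ j ihj =>
        refine isOfFinOrder_altProd_of_odd (hk ▸ ho) (isOfFinOrder_wordProd fun l' h hs => ?_)
        rw [countA_append, add_comm, hc] at h
        rw [sum_sectionWord] at hs
        rcases (h.trans_le (hle.trans_eq hk)).lt_or_eq with hlt | heq
        · exact ih _ hlt hω.shift l' rfl
        · exact ihj hω.shift l' heq (hs ▸ hj) (countA_sectionWord_add _ _) List.countP_le_length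

theorem exists_wordProd_eq {ω : ℕ → Fin 3} {g : Equiv.Perm (List Bool)}
    (hg : g ∈ grigorchukGroup ω) : ∃ l, g = wordProd ω l := by
  induction hg using grigorchukGroup_induction with
  | one => exact ⟨[], rfl⟩
  | genA_mul g _ ih =>
    obtain ⟨l, rfl⟩ := ih
    exact ⟨(0, 1) :: l, by simp [powA]⟩
  | directed_mul x g _ ih =>
    obtain ⟨l, rfl⟩ := ih
    exact ⟨(x, 0) :: l, by simp⟩

/-- If every letter occurs infinitely often in `ω`, then `G_ω` is a torsion group. -/
theorem isOfFinOrder_of_mem {ω : ℕ → Fin 3} (hω : EveryLetterOften ω)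
    {g : Equiv.Perm (List Bool)} (hg : g ∈ grigorchukGroup ω) : IsOfFinOrder g := by
  obtain ⟨l, rfl⟩ := exists_wordProd_eq hg
  exact isOfFinOrder_wordProd fun l' _ _ => isOfFinOrder_altProd hω l'

end GrigorchukFamily

/-! ### Rigid stabilizers, and finite index criteria -/

namespace GrigorchukFamily

/-- The union of ⟨ab⟩ and a⟨ab⟩ is stable under left multiplication by a and b, hence is the whole
group. -/
theorem finite_of_closure_involutions {Q : Type*} [Group Q] {a b : Q} (ha : a * a = 1)
    (hb : b * b = 1) (hab : IsOfFinOrder (a * b)) (h : Subgroup.closure {a, b} = ⊤) :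
    Finite Q := by
  have hfin : (Subgroup.zpowers (a * b) : Set Q).Finite :=
    hab.finite_zpowers
  have hconj : ∀ n : ℤ, (a * b) ^ n * a = a * (a * b) ^ (-n) := by
    intro n
    have h1 : a⁻¹ = a := inv_eq_of_mul_eq_one_left ha
    have h2 : (a * b)⁻¹ = a * (a * b) * a⁻¹ := by
      rw [mul_inv_rev, h1, inv_eq_of_mul_eq_one_left hb, ← mul_assoc a a, ha, one_mul]
    rw [zpow_neg, ← inv_zpow, h2, conj_zpow, h1, ← mul_assoc, ← mul_assoc, ha, one_mul]
  have hall : ∀ x : Q, x ∈ Subgroup.zpowers (a * b) ∨ a * x ∈ Subgroup.zpowers (a * b) := by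
    intro x
    have hx : x ∈ Subgroup.closure {a, b} := h ▸ Subgroup.mem_top x
    have hainv : a⁻¹ = a := inv_eq_of_mul_eq_one_left ha
    have hbinv : b⁻¹ = b := inv_eq_of_mul_eq_one_left hb
    have stepa : ∀ y, (y ∈ Subgroup.zpowers (a * b) ∨ a * y ∈ Subgroup.zpowers (a * b)) →
        (a * y ∈ Subgroup.zpowers (a * b) ∨ a * (a * y) ∈ Subgroup.zpowers (a * b)) := by
      intro y hy
      rw [← mul_assoc, ha, one_mul]
      exact hy.symm
    have stepb : ∀ y, (y ∈ Subgroup.zpowers (a * b) ∨ a * y ∈ Subgroup.zpowers (a * b)) →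
        (b * y ∈ Subgroup.zpowers (a * b) ∨ a * (b * y) ∈ Subgroup.zpowers (a * b)) := by
      rintro y (hy | hy)
      · right
        rw [← mul_assoc]
        exact mul_mem (Subgroup.mem_zpowers _) hy
      · left
        have : b * y = (a * b)⁻¹ * (a * y) := by
          rw [mul_inv_rev, hainv, hbinv, mul_assoc, ← mul_assoc a a, ha, one_mul]
        rw [this]
        exact mul_mem (inv_mem (Subgroup.mem_zpowers _)) hy
    induction hx using Subgroup.closure_induction_left with
    | one => exact .inl (one_mem _)
    | mul_left x hx y _ ih =>
      rcases hx with rfl | rfl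
      exacts [stepa _ ih, stepb _ ih]
    | inv_mul_cancel x hx y _ ih =>
      rcases hx with rfl | rfl
      · rw [hainv]
        exact stepa _ ih
      · rw [hbinv]
        exact stepb _ ih
  refine Set.finite_univ_iff.1 ((hfin.union (hfin.image fun y => a⁻¹ * y)).subset ?_)
  intro x _
  rcases hall x with hx | hx
  · exact .inl hx
  · exact .inr ⟨a * x, hx, by simp⟩

theorem exists_ne_zero_letterHom_eq_zero (i : Fin 3) : ∃ x, x ≠ 0 ∧ letterHom i x = 0 := by
  fin_cases i
  exacts [⟨kd, by decide⟩, ⟨kc, by decide⟩, ⟨kb, by decide⟩]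

/-- If every letter occurs infinitely often, then the rigid stabilizer of a child of the root has
finite index in `G_{𝔰ω}`. -/
theorem relIndex_comap_child_ne_zero {ω : ℕ → Fin 3} (hω : EveryLetterOften ω) (b : Bool) :
    ((grigorchukGroup ω).comap (child b)).relIndex (grigorchukGroup (shift ω)) ≠ 0 := by
  have hb : (grigorchukGroup ω).comap (child b) = (grigorchukGroup ω).comap (child true) := by
    cases b
    · ext g
      have : child false g = genA * child true g * genA := by
        rw [genA_mul_child, mul_assoc, genA_mul_genA, mul_one, Bool.not_true]
      rw [Subgroup.mem_comap, Subgroup.mem_comap, this,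
        Subgroup.mul_mem_cancel_right _ (genA_mem ω), Subgroup.mul_mem_cancel_left _ (genA_mem ω)]
    · rfl
  rw [hb]
  set N := ((grigorchukGroup ω).comap (child true)).subgroupOf (grigorchukGroup (shift ω)) with hN
  -- Conjugating by g below the second child is the same as conjugating by a lift of g that
  -- stabilizes this child.
  have hnormal : N.Normal := by
    refine ⟨fun n hn g => ?_⟩
    obtain ⟨h, hh, H⟩ := exists_lift g.2
    have key : child true (g * n * g⁻¹ : Equiv.Perm (List Bool)) = h * child true n * h⁻¹ := by
      rw [eq_mul_inv_iff_mul_eq]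
      have ht : ∀ v, ∃ w, h (false :: v) = false :: w := by
        intro v
        have htree := grigorchukGroup_le_treeAut _ hh
        have h1 := length_apply htree (false :: v)
        rcases h2 : h (false :: v) with _ | ⟨_ | _, w⟩
        · simp [h2] at h1
        · exact ⟨w, rfl⟩
        · have : h (true :: g⁻¹.1 w) = h (false :: v) := by
            rw [H, h2]
            exact congrArg _ (Equiv.apply_symm_apply _ _)
          simpa using h.injective this
      have hnil : h [] = [] := by
        simpa using length_apply (grigorchukGroup_le_treeAut _ hh) []
      have hk : ∀ v, (g * n * g⁻¹ : Equiv.Perm (List Bool)) (g.1 v) = g.1 (n.1 v) := fun v =>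
        congrArg (fun w => g.1 (n.1 w)) (g.1.symm_apply_apply v)
      generalize (g * n * g⁻¹ : Equiv.Perm (List Bool)) = k at hk
      ext1 v
      rcases v with _ | ⟨_ | _, v⟩
      · simp [hnil]
      · obtain ⟨w, hw⟩ := ht v
        simp [hw]
      · simp [H, hk]
    rw [hN, Subgroup.mem_subgroupOf, Subgroup.mem_comap] at hn ⊢
    have := mul_mem (mul_mem hh hn) (inv_mem hh)
    rw [← key] at this
    exact this
  -- Since ω₀ kills x₀, the element x₀ of G_ω acts only below the second child, so x₀ of G_{𝔰ω} dies
  -- in the quotient by N. There remain two involutions, a and y₀, whose product has finite order by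
  -- torsion.
  obtain ⟨x₀, hx₀, hker⟩ := exists_ne_zero_letterHom_eq_zero (ω 0)
  obtain ⟨y₀, hy₀⟩ : ∃ y₀ : Klein, ∀ x, x = 0 ∨ x = x₀ ∨ x = y₀ ∨ x = y₀ + x₀ := by
    have : ∀ x₀ : Klein, x₀ ≠ 0 → ∃ y₀, ∀ x, x = 0 ∨ x = x₀ ∨ x = y₀ ∨ x = y₀ + x₀ := by decide
    exact this x₀ hx₀
  have hx₀N : (⟨directed x₀ (shift ω), directed_mem _ _⟩ : grigorchukGroup (shift ω)) ∈ N := by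
    rw [hN, Subgroup.mem_subgroupOf, Subgroup.mem_comap]
    have := directed_mem x₀ ω
    rwa [directed_eq, hker, powA_zero, map_one, one_mul] at this
  let mk := QuotientGroup.mk' N
  let A : grigorchukGroup (shift ω) := ⟨genA, genA_mem _⟩
  let B : Klein → grigorchukGroup (shift ω) := fun x => ⟨directed x (shift ω), directed_mem _ _⟩
  have hBadd : ∀ x y, B (x + y) = B x * B y := fun x y => Subtype.ext (directed_add x y _)
  have hB0 : B 0 = 1 := Subtype.ext (directed_zero _)
  have hBx₀ : mk (B x₀) = 1 := (QuotientGroup.eq_one_iff _).2 hx₀N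
  have hfin : Finite (grigorchukGroup (shift ω) ⧸ N) := by
    refine finite_of_closure_involutions (a := mk A) (b := mk (B y₀)) ?_ ?_ ?_ ?_
    · rw [← map_mul, ← map_one mk]
      exact congrArg mk (Subtype.ext genA_mul_genA)
    · rw [← map_mul, ← map_one mk]
      exact congrArg mk (Subtype.ext (directed_mul_self _ _))
    · rw [← map_mul]
      refine mk.isOfFinOrder ?_
      refine (Subgroup.subtype_injective _).isOfFinOrder_iff.1 ?_
      exact isOfFinOrder_of_mem hω.shift (A * B y₀).2
    · rw [eq_top_iff]
      rintro q -
      obtain ⟨⟨g, hg⟩, rfl⟩ := QuotientGroup.mk'_surjective N q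
      have hBmem : ∀ x, mk (B x) ∈ Subgroup.closure {mk A, mk (B y₀)} := by
        intro x
        rcases hy₀ x with rfl | rfl | rfl | rfl
        · rw [hB0, map_one]
          exact one_mem _
        · rw [hBx₀]
          exact one_mem _
        · exact Subgroup.subset_closure (by simp)
        · rw [hBadd, map_mul, hBx₀, mul_one]
          exact Subgroup.subset_closure (by simp)
      induction hg using grigorchukGroup_induction with
      | one => exact one_mem _
      | genA_mul g hg ih =>
        exact mul_mem (Subgroup.subset_closure (by simp) :
          mk A ∈ Subgroup.closure {mk A, mk (B y₀)}) ih
      | directed_mul x g hg ih => exact mul_mem (hBmem x) ih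
  exact (Subgroup.finiteIndex_of_finite_quotient (H := N)).index_ne_zero

/-- If every letter occurs infinitely often, then the rigid stabilizers of the vertices have finite
index. -/
theorem relIndex_comap_cone_ne_zero {ω : ℕ → Fin 3} (hω : EveryLetterOften ω) (u : List Bool) :
    ((grigorchukGroup ω).comap (cone u)).relIndex (grigorchukGroup (shift^[u.length] ω)) ≠ 0 := by
  induction u generalizing ω with
  | nil => simp [cone]
  | cons b u ih =>
    rw [cone, ← Subgroup.comap_comap]
    exact Subgroup.relIndex_ne_zero_trans
      (Subgroup.relIndex_comap_ne_zero _ (relIndex_comap_child_ne_zero hω b)) (ih hω.shift)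

theorem relIndex_ne_zero_of_le_right {G : Type*} [Group G] {H K L : Subgroup G} (hKL : K ≤ L)
    (h : H.relIndex L ≠ 0) : H.relIndex K ≠ 0 :=
  mt (Subgroup.relIndex_eq_zero_of_le_right hKL) h

theorem relIndex_ne_zero_of_le_left {G : Type*} [Group G] {H K L : Subgroup G} (hHK : H ≤ K)
    (h : H.relIndex L ≠ 0) : K.relIndex L ≠ 0 :=
  mt (Subgroup.relIndex_eq_zero_of_le_left hHK) h

/-- A subgroup has finite index in `G_ω` if it contains finite index subgroups of the copies of
`G_{𝔰ω}` below both children of the root. -/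
theorem relIndex_ne_zero_of_child {ω : ℕ → Fin 3} {K : Subgroup (Equiv.Perm (List Bool))}
    (h : ∀ b, (K.comap (child b)).relIndex (grigorchukGroup (shift ω)) ≠ 0) :
    K.relIndex (grigorchukGroup ω) ≠ 0 := by
  let p := MonoidHom.noncommCoprod (child false) (child true) child_commute
  have hp : Function.Injective p := by
    rintro ⟨g, h⟩ ⟨g', h'⟩ H
    simp only [p, MonoidHom.noncommCoprod_apply] at H
    refine Prod.ext (Equiv.ext fun v => ?_) (Equiv.ext fun v => ?_)
    · simpa using DFunLike.congr_fun H (false :: v)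
    · simpa using DFunLike.congr_fun H (true :: v)
  let S := (grigorchukGroup (shift ω)).prod (grigorchukGroup (shift ω))
  have h₁ : (K.comap p).relIndex S ≠ 0 := by
    refine relIndex_ne_zero_of_le_left (H := (K.comap (child false)).comap (MonoidHom.fst _ _) ⊓
      (K.comap (child true)).comap (MonoidHom.snd _ _)) ?_ (Subgroup.relIndex_inf_ne_zero ?_ ?_)
    · rintro ⟨g, h⟩ ⟨hg, hh⟩
      exact K.mul_mem hg hh
    · exact relIndex_ne_zero_of_le_right (fun x hx => hx.1)
        (Subgroup.relIndex_comap_ne_zero _ (h false))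
    · exact relIndex_ne_zero_of_le_right (fun x hx => hx.2)
        (Subgroup.relIndex_comap_ne_zero _ (h true))
  rw [← Subgroup.relIndex_map_map_of_injective _ _ hp] at h₁
  refine Subgroup.relIndex_ne_zero_trans (K := S.map p)
    (relIndex_ne_zero_of_le_left (Subgroup.map_comap_le _ _) h₁) fun h0 => ?_
  have : (S.map p).relIndex (grigorchukGroup ω) ∣ 2 := by
    refine Subgroup.relIndex_dvd_two_iff.2 ⟨genA, genA_mem ω, fun g hg => ?_⟩
    obtain ⟨g₀, h₀, g₁, h₁, e, rfl⟩ := exists_sections hg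
    have hmem : child false g₀ * child true g₁ ∈ S.map p := ⟨(g₀, g₁), ⟨h₀, h₁⟩, rfl⟩
    by_cases he : e = 0
    · right
      simpa [he] using hmem
    · left
      simpa [powA_of_ne he, mul_assoc] using hmem
  rw [h0] at this
  simp at this

theorem relIndex_ne_zero_of_cone (n : ℕ) {ω : ℕ → Fin 3} {K : Subgroup (Equiv.Perm (List Bool))}
    (h : ∀ u : List Bool, u.length = n →
      (K.comap (cone u)).relIndex (grigorchukGroup (shift^[n] ω)) ≠ 0) :
    K.relIndex (grigorchukGroup ω) ≠ 0 := by
  induction n generalizing ω K with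
  | zero => simpa [cone] using h [] rfl
  | succ n ih =>
    refine relIndex_ne_zero_of_child fun b => ih fun u hu => ?_
    have := h (b :: u) (by simp [hu])
    rwa [cone, ← Subgroup.comap_comap] at this

instance (ω : ℕ → Fin 3) : Group.FG (grigorchukGroup ω) :=
  inferInstanceAs (Group.FG (Subgroup.closure _))

instance (ω : ℕ → Fin 3) : Countable (grigorchukGroup ω) := by
  refine Function.Injective.countable
    (f := fun g : grigorchukGroup ω => (exists_wordProd_eq g.2).choose) fun g h H => ?_
  have := congrArg (wordProd ω) H
  rwa [← (exists_wordProd_eq g.2).choose_spec, ← (exists_wordProd_eq h.2).choose_spec,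
    ← Subtype.ext_iff] at this

/-- Derived subgroups of finite index subgroups of finitely generated torsion groups have finite
index. -/
theorem relIndex_commutator_ne_zero {G : Type*} [Group G] {Q L : Subgroup G} (hQL : Q ≤ L)
    [Group.FG L] (hL : ∀ g ∈ L, IsOfFinOrder g) (h : Q.relIndex L ≠ 0) :
    (⁅Q, Q⁆ : Subgroup G).relIndex L ≠ 0 := by
  refine Subgroup.relIndex_ne_zero_trans (K := Q) ?_ h
  have : (Q.subgroupOf L).FiniteIndex := ⟨h⟩
  have : Group.FG Q := Group.fg_of_surjective
    (f := (Subgroup.subgroupOfEquivOfLe hQL).toMonoidHom)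
    (Subgroup.subgroupOfEquivOfLe hQL).surjective
  have : Group.FG (Abelianization Q) :=
    Group.fg_of_surjective (f := Abelianization.of) QuotientGroup.mk_surjective
  have : Finite (Q ⧸ commutator Q) := by
    refine CommGroup.finite_of_fg_isMulTorsion (Abelianization Q) fun x => ?_
    obtain ⟨x, rfl⟩ := QuotientGroup.mk_surjective x
    exact Abelianization.of.isOfFinOrder
      ((Subgroup.subtype_injective _).isOfFinOrder_iff.1 (hL x (hQL x.2)))
  rw [← Subgroup.map_subtype_commutator, Subgroup.relIndex, Subgroup.subgroupOf,
    Subgroup.comap_map_eq_self_of_injective (Subgroup.subtype_injective _)]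
  exact (Subgroup.finiteIndex_of_finite_quotient (H := commutator Q)).index_ne_zero

end GrigorchukFamily

/-! ### Invariant random subgroups of countable groups -/

namespace InvariantRandomSubgroup

variable {G : Type*} [Group G]

theorem measurableSet_setOf_mem (g : G) : MeasurableSet {H : Subgroup G | g ∈ H} := by
  have h : Continuous fun H : Subgroup G => (open Classical in decide (g ∈ H) : Bool) :=
    have : Continuous fun (H : Subgroup G) (g : G) =>
      (open Classical in decide (g ∈ H) : Bool) := continuous_induced_dom
    (continuous_apply g).comp this
  have := (isOpen_discrete {true}).preimage h
  convert this.measurableSet using 1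
  ext H
  simp

theorem measurable_mem (g : G) : Measurable fun H : Subgroup G => g ∈ H :=
  measurableSet_setOfPred.1 (measurableSet_setOf_mem g)

/-- For countable G the Borel sigma-algebra of the product `G → Bool` is the product sigma-algebra,
so coordinates suffice. -/
theorem measurable_of_mem [Countable G] {X : Type*} [MeasurableSpace X] {Φ : X → Subgroup G}
    (h : ∀ g, Measurable fun x => g ∈ Φ x) : Measurable Φ := by
  have hborel : chabautyMeasurableSpace G = MeasurableSpace.comap
      (fun (H : Subgroup G) (g : G) => (open Classical in decide (g ∈ H) : Bool))
      MeasurableSpace.pi := by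
    rw [BorelSpace.measurable_eq (α := G → Bool)]
    exact borel_comap
  rw [hborel, measurable_comap_iff, measurable_pi_iff]
  intro g
  refine measurable_to_bool ?_
  convert measurableSet_setOfPred.2 (h g) using 1
  ext x
  simp

theorem tendsto_of_eventually_mem {Φ : ℕ → Subgroup G} {H : Subgroup G}
    (h : ∀ g, ∀ᶠ n in atTop, (g ∈ Φ n ↔ g ∈ H)) : Tendsto Φ atTop (𝓝 H) := by
  rw [nhds_induced, tendsto_comap_iff, tendsto_pi_nhds]
  intro g
  refine tendsto_nhds_of_eventually_eq ?_
  filter_upwards [h g] with n hn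
  simp [hn]

/-- Over a countable group the right side is a countable combination of membership events, which
gives measurability. -/
theorem finiteIndex_iff_exists_finset {H : Subgroup G} :
    H.FiniteIndex ↔ ∃ F : Finset G, ∀ g, ∃ f ∈ F, f⁻¹ * g ∈ H := by
  rw [Subgroup.finiteIndex_iff_finite_quotient]
  constructor
  · intro h
    classical
    have := Fintype.ofFinite (G ⧸ H)
    refine ⟨Finset.univ.image (Quotient.out : G ⧸ H → G), fun g => ?_⟩
    exact ⟨_, Finset.mem_image_of_mem _ (Finset.mem_univ (g : G ⧸ H)),
      QuotientGroup.eq.1 (QuotientGroup.out_eq' _)⟩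
  · rintro ⟨F, hF⟩
    refine Finite.of_surjective (fun f : F => (f.1 : G ⧸ H)) fun q => ?_
    obtain ⟨g, rfl⟩ := QuotientGroup.mk_surjective q
    obtain ⟨f, hf, h⟩ := hF g
    exact ⟨⟨f, hf⟩, QuotientGroup.eq.2 h⟩

theorem measurableSet_finiteIndex [Countable G] :
    MeasurableSet {H : Subgroup G | H.FiniteIndex} := by
  simp only [finiteIndex_iff_exists_finset]
  exact measurableSet_setOfPred.2 (Measurable.exists fun F => Measurable.forall fun g =>
    Measurable.exists fun f => measurable_const.and (measurable_mem _))

theorem mem_map_conj {g x : G} {H : Subgroup G} :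
    x ∈ H.map (MulAut.conj g).toMonoidHom ↔ g⁻¹ * x * g ∈ H := by
  constructor
  · rintro ⟨y, hy, rfl⟩
    simpa [mul_assoc] using hy
  · intro h
    exact ⟨_, h, by simp [mul_assoc]⟩

/-- An invariant random subgroup is co-sofic if it is approximated by finite index subgroups that
depend on the subgroup in a measurable and equivariant way. -/
theorem IsIRS.isCosofic_of_tendsto [Countable G] {μ : ProbabilityMeasure (Subgroup G)}
    (hμ : IsIRS μ) (Φ : ℕ → Subgroup G → Subgroup G) (hΦ : ∀ n, Measurable (Φ n))
    (hconj : ∀ n g H, Φ n (H.map (MulAut.conj g).toMonoidHom) =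
      (Φ n H).map (MulAut.conj g).toMonoidHom)
    (hfin : ∀ n, ∀ᵐ H ∂(μ : Measure (Subgroup G)), (Φ n H).FiniteIndex)
    (hlim : ∀ᵐ H ∂(μ : Measure (Subgroup G)), Tendsto (fun n => Φ n H) atTop (𝓝 H)) :
    IsCosofic μ := by
  refine ⟨fun n => μ.map (hΦ n).aemeasurable, fun n => ⟨fun g => ?_, ?_⟩, ?_⟩
  · refine ⟨(hμ g).measurable, ?_⟩
    rw [ProbabilityMeasure.toMeasure_map, Measure.map_map (hμ g).measurable (hΦ n)]
    have : (fun H : Subgroup G => H.map (MulAut.conj g).toMonoidHom) ∘ Φ n =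
        Φ n ∘ fun H : Subgroup G => H.map (MulAut.conj g).toMonoidHom :=
      funext fun H => (hconj n g H).symm
    rw [this, ← Measure.map_map (hΦ n) (hμ g).measurable, (hμ g).map_eq]
  · rw [ProbabilityMeasure.toMeasure_map]
    exact (ae_map_iff (hΦ n).aemeasurable measurableSet_finiteIndex).2 (hfin n)
  · rw [ProbabilityMeasure.tendsto_iff_forall_integral_tendsto]
    intro f
    have : ∀ n, ∫ H, f H ∂(μ.map (hΦ n).aemeasurable : Measure (Subgroup G)) =
        ∫ H, f (Φ n H) ∂(μ : Measure (Subgroup G)) := fun n => by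
      rw [ProbabilityMeasure.toMeasure_map]
      exact integral_map (hΦ n).aemeasurable f.continuous.measurable.aestronglyMeasurable
    simp only [this]
    refine tendsto_integral_of_dominated_convergence (fun _ => ‖f‖) (fun n =>
      (f.continuous.measurable.comp (hΦ n)).aestronglyMeasurable) (integrable_const _)
      (fun n => .of_forall fun H => f.norm_coe_le_norm _) ?_
    filter_upwards [hlim] with H hH
    exact (f.continuous.tendsto H).comp hH

/-- The projection to `L` of the intersection of `H` with the product of `L` and its conjugate
under `g`, where these two groups commute. -/
def projSubgroup (L : Subgroup G) (g : G) (hL : ∀ x ∈ L, ∀ y ∈ L, Commute x (g * y * g⁻¹))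
    (H : Subgroup G) : Subgroup G where
  carrier := {x | x ∈ L ∧ ∃ y ∈ L, x * (g * y * g⁻¹) ∈ H}
  one_mem' := ⟨one_mem _, 1, one_mem _, by simp⟩
  mul_mem' := by
    rintro x x' ⟨hx, y, hy, h⟩ ⟨hx', y', hy', h'⟩
    refine ⟨mul_mem hx hx', y * y', mul_mem hy hy', ?_⟩
    have := mul_mem h h'
    rw [mul_assoc, ← mul_assoc (g * y * g⁻¹), ← (hL x' hx' y hy).eq] at this
    simpa [mul_assoc] using this
  inv_mem' := by
    rintro x ⟨hx, y, hy, h⟩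
    refine ⟨inv_mem hx, y⁻¹, inv_mem hy, ?_⟩
    have := inv_mem h
    rw [(hL x hx y hy).eq] at this
    simpa [mul_assoc] using this

theorem mem_projSubgroup {L : Subgroup G} {g : G}
    {hL : ∀ x ∈ L, ∀ y ∈ L, Commute x (g * y * g⁻¹)} {H : Subgroup G} {x : G} :
    x ∈ projSubgroup L g hL H ↔ x ∈ L ∧ ∃ y ∈ L, x * (g * y * g⁻¹) ∈ H := Iff.rfl

/-- Since k ∈ L commutes with g L g⁻¹, conjugation by k changes only the first factor. -/
theorem projSubgroup_conj {L : Subgroup G} {g : G}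
    (hL : ∀ x ∈ L, ∀ y ∈ L, Commute x (g * y * g⁻¹)) (H : Subgroup G) {k : G} (hk : k ∈ L)
    {x : G} : x ∈ projSubgroup L g hL (H.map (MulAut.conj k).toMonoidHom) ↔
      k⁻¹ * x * k ∈ projSubgroup L g hL H := by
  simp only [mem_projSubgroup, mem_map_conj, L.mul_mem_cancel_right hk,
    L.mul_mem_cancel_left (inv_mem hk)]
  refine and_congr_right fun _ => exists_congr fun y => and_congr_right fun hy => ?_
  have : k⁻¹ * (x * (g * y * g⁻¹)) * k = k⁻¹ * x * k * (g * y * g⁻¹) := by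
    rw [mul_assoc _ k, (hL k hk y hy).eq]
    simp only [mul_assoc]
  rw [this]

/-- If `H` is an invariant random subgroup and `g ∈ H`, then the projection to `L` of the
intersection of `H` with `L × g L g⁻¹` has finite index in `L`. -/
theorem IsIRS.ae_relIndex_projSubgroup_ne_zero [Countable G] {μ : ProbabilityMeasure (Subgroup G)}
    (hμ : IsIRS μ) (L : Subgroup G) (g : G)
    (hL : ∀ x ∈ L, ∀ y ∈ L, Commute x (g * y * g⁻¹)) :
    ∀ᵐ H ∂(μ : Measure (Subgroup G)), g ∈ H → (projSubgroup L g hL H).relIndex L ≠ 0 := by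
  obtain ⟨e, he⟩ := exists_injective_nat G
  -- `T P` selects from each coset xP in L the element with the least number, so the number of x
  -- with `H ∈ A x` is the index of the projection when g ∈ H.
  let T : Subgroup G → G → Prop := fun P x => x ∈ L ∧ ∀ y ∈ L, y⁻¹ * x ∈ P → e x ≤ e y
  let A : G → Set (Subgroup G) := fun x => {H | g ∈ H ∧ T (projSubgroup L g hL H) x}
  have hA : ∀ x, MeasurableSet (A x) := by
    intro x
    refine measurableSet_setOfPred.2 ((measurable_mem g).and (measurable_const.and ?_))
    refine Measurable.forall fun y => measurable_const.imp (Measurable.imp ?_ measurable_const)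
    exact measurable_const.and (Measurable.exists fun z => measurable_const.and (measurable_mem _))
  let B : G → Set (Subgroup G) := fun x =>
    (fun H : Subgroup G => H.map (MulAut.conj x⁻¹).toMonoidHom) ⁻¹' A x
  -- If H lies in `B x` and `B x'`, put z = x⁻¹Hx and k = x'⁻¹x. Both g and k⁻¹gk lie in z, so
  -- k⁻¹·gkg⁻¹ does too, and k lies in the projection P of z. Conjugation by k thus preserves P, and
  -- x, x' are both the least element of one coset of P.
  have hdisj : Pairwise (Function.onFun Disjoint B) := by
    intro x x' hne
    refine Set.disjoint_left.2 fun H hH hH' => hne ?_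
    obtain ⟨hg, hx, hmin⟩ := hH
    obtain ⟨hg', hx', hmin'⟩ := hH'
    rw [mem_map_conj, inv_inv] at hg hg'
    have hk : x'⁻¹ * x ∈ L := mul_mem (inv_mem hx') hx
    set z := H.map (MulAut.conj x⁻¹).toMonoidHom with hz
    have hz' : H.map (MulAut.conj x'⁻¹).toMonoidHom =
        z.map (MulAut.conj (x'⁻¹ * x)).toMonoidHom := by
      ext y
      rw [mem_map_conj, mem_map_conj, hz, mem_map_conj]
      simp [mul_assoc]
    have hmem : x'⁻¹ * x ∈ projSubgroup L g hL z := by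
      rw [← inv_mem_iff]
      refine ⟨inv_mem hk, x'⁻¹ * x, hk, ?_⟩
      rw [hz, mem_map_conj]
      have := mul_mem hg' (inv_mem hg)
      simpa [mul_assoc] using this
    beta_reduce at hmin'
    rw [hz'] at hmin'
    refine he (le_antisymm (hmin _ hx' hmem) (hmin' _ hx ?_))
    rw [projSubgroup_conj hL z hk]
    have := inv_mem hmem
    have := mul_mem (mul_mem this this) hmem
    simpa [mul_assoc] using this
  -- By invariance `A x` and `B x` have equal measure, and the `B x` are disjoint in a probability
  -- space. The Borel–Cantelli lemma then leaves finitely many cosets almost surely.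
  have hsum : ∑' x, (μ : Measure (Subgroup G)) (A x) ≠ ⊤ := by
    have h1 : ∀ x, (μ : Measure (Subgroup G)) (A x) = (μ : Measure (Subgroup G)) (B x) :=
      fun x => ((hμ x⁻¹).measure_preimage (hA x).nullMeasurableSet).symm
    simp only [h1]
    rw [← measure_iUnion hdisj fun x => (hμ x⁻¹).measurable (hA x)]
    exact measure_ne_top _ _
  filter_upwards [ae_finite_setOfPred_mem hsum] with H hfin hg
  set P := projSubgroup L g hL H
  have hT : {x | T P x}.Finite := hfin.subset fun x hx => ⟨hg, hx⟩
  have : Finite (L ⧸ P.subgroupOf L) := by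
    have := hT.to_subtype
    refine Finite.of_surjective
      (fun x : {x | T P x} => (QuotientGroup.mk ⟨x.1, x.2.1⟩ : L ⧸ P.subgroupOf L)) fun q => ?_
    obtain ⟨⟨l, hl⟩, rfl⟩ := QuotientGroup.mk_surjective q
    have hne : {x | x ∈ L ∧ l⁻¹ * x ∈ P}.Nonempty := ⟨l, hl, by simp⟩
    obtain ⟨x, ⟨hx, hlx⟩, hmin⟩ := exists_minimalFor_of_wellFoundedLT
      (fun x => x ∈ L ∧ l⁻¹ * x ∈ P) e hne
    refine ⟨⟨x, hx, fun y hy hyx => ?_⟩, ?_⟩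
    · refine (le_total (e x) (e y)).elim id fun h => hmin ⟨hy, ?_⟩ h
      have := mul_mem hlx (inv_mem hyx)
      simpa [mul_assoc] using this
    · refine (QuotientGroup.eq.2 ?_).symm
      exact Subgroup.mem_subgroupOf.2 hlx
  exact (Subgroup.finiteIndex_of_finite_quotient (H := P.subgroupOf L)).index_ne_zero

end InvariantRandomSubgroup

/-! ### Large projections and the commutator trick -/

namespace GrigorchukFamily
open InvariantRandomSubgroup

/-- The permutation `x` fixes all words that do not have the prefix `u`. -/
def SupportedBelow (u : List Bool) (x : Equiv.Perm (List Bool)) : Prop :=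
  ∀ z, ¬ u <+: z → x z = z

theorem supportedBelow_cone (u : List Bool) (x : Equiv.Perm (List Bool)) :
    SupportedBelow u (cone u x) := fun _ h => cone_apply_of_not_prefix h x

theorem eq_of_prefix_of_prefix {u v z : List Bool} (hu : u <+: z) (hv : v <+: z)
    (h : u.length = v.length) : u = v :=
  (List.prefix_of_prefix_length_le hu hv h.le).eq_of_length h

theorem SupportedBelow.commute {u v : List Bool} {x y : Equiv.Perm (List Bool)}
    (hx : SupportedBelow u x) (hy : SupportedBelow v y) (huv : u ≠ v)
    (h : u.length = v.length) : Commute x y := by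
  refine Equiv.Perm.Disjoint.commute fun z => ?_
  by_cases hu : u <+: z
  · exact .inr (hy z fun hv => huv (eq_of_prefix_of_prefix hu hv h))
  · exact .inl (hx z hu)

theorem SupportedBelow.conj {u : List Bool} {y g : Equiv.Perm (List Bool)}
    (hy : SupportedBelow u y) (hg : g ∈ treeAut) : SupportedBelow (g u) (g * y * g⁻¹) := by
  intro z hz
  obtain ⟨z, rfl⟩ := g.surjective z
  rw [prefix_apply_iff hg] at hz
  have : g⁻¹ (g z) = z := g.symm_apply_apply z
  rw [Equiv.Perm.mul_apply, Equiv.Perm.mul_apply, this, hy z hz]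

/-- The rigid stabilizer of the vertex `u`. -/
def rigidStabilizer (ω : ℕ → Fin 3) (u : List Bool) : Subgroup (grigorchukGroup ω) :=
  (cone u).range.subgroupOf (grigorchukGroup ω)

theorem supportedBelow_of_mem {ω : ℕ → Fin 3} {u : List Bool} {x : grigorchukGroup ω}
    (hx : x ∈ rigidStabilizer ω u) : SupportedBelow u x := by
  obtain ⟨y, hy⟩ := hx
  have : cone u y = x := hy
  exact this ▸ supportedBelow_cone u y

/-- For every element `g` of `K` and every vertex `u` that it moves, the intersection of `K` with
the product of the rigid stabilizers of `u` and `g u` has a large projection. -/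
def HasLargeProjections (ω : ℕ → Fin 3) (K : Subgroup (Equiv.Perm (List Bool))) : Prop :=
  ∀ g ∈ K, ∀ u, g u ≠ u → ∃ Q : Subgroup (Equiv.Perm (List Bool)),
    Q.relIndex (grigorchukGroup (shift^[u.length] ω)) ≠ 0 ∧
      ∀ x ∈ Q, ∃ y, SupportedBelow (g u) y ∧ cone u x * y ∈ K

/-- There are only countably many pairs of g and u. The index bound relative to the rigid stabilizer
passes to the copy of the shifted group because the rigid stabilizer has finite index there. -/
theorem ae_hasLargeProjections {ω : ℕ → Fin 3} (hω : EveryLetterOften ω)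
    {μ : ProbabilityMeasure (Subgroup (grigorchukGroup ω))} (hμ : IsIRS μ) :
    ∀ᵐ H ∂(μ : Measure (Subgroup (grigorchukGroup ω))),
      HasLargeProjections ω (H.map (grigorchukGroup ω).subtype) := by
  have hcomm : ∀ (g : grigorchukGroup ω) (u : List Bool), g.1 u ≠ u →
      ∀ x ∈ rigidStabilizer ω u, ∀ y ∈ rigidStabilizer ω u, Commute x (g * y * g⁻¹) := by
    intro g u hgu x hx y hy
    have hg := grigorchukGroup_le_treeAut ω g.2
    exact Subtype.ext ((supportedBelow_of_mem hx).commute ((supportedBelow_of_mem hy).conj hg)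
      hgu.symm (length_apply hg u).symm)
  have key : ∀ᵐ H ∂(μ : Measure (Subgroup (grigorchukGroup ω))), ∀ (g : grigorchukGroup ω) u,
      ∀ h : g.1 u ≠ u, g ∈ H → (projSubgroup (rigidStabilizer ω u) g (hcomm g u h) H).relIndex
        (rigidStabilizer ω u) ≠ 0 := by
    refine ae_all_iff.2 fun g => ae_all_iff.2 fun u => ae_all_iff.2 fun h => ?_
    exact hμ.ae_relIndex_projSubgroup_ne_zero _ g _
  filter_upwards [key] with H hH
  rintro _ ⟨g, hg, rfl⟩ u hgu
  have h := hH g u hgu hg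
  set R := projSubgroup (rigidStabilizer ω u) g (hcomm g u hgu) H
  rw [← Subgroup.relIndex_map_map_of_injective _ _ (Subgroup.subtype_injective _)] at h
  have h' := Subgroup.relIndex_comap_ne_zero (cone u) h
  rw [rigidStabilizer, Subgroup.subgroupOf_map_subtype] at h'
  refine ⟨(R.map (grigorchukGroup ω).subtype).comap (cone u), Subgroup.relIndex_ne_zero_trans
    (relIndex_ne_zero_of_le_right ?_ h') (relIndex_comap_cone_ne_zero hω u), ?_⟩
  · exact fun x hx => ⟨⟨x, rfl⟩, hx⟩
  · rintro x ⟨p, ⟨hp, y, hy, hpy⟩, hpx⟩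
    refine ⟨g * y * g⁻¹, (supportedBelow_of_mem hy).conj (grigorchukGroup_le_treeAut ω g.2), ?_⟩
    exact ⟨_, hpy, congrArg (· * (g * y * g⁻¹ : Equiv.Perm (List Bool))) hpx⟩

/-- By transitivity the orbit of v is its whole level. So a subgroup of small finite index cannot
fix a deep vertex. -/
theorem two_pow_le_relIndex_stabilizer (ω : ℕ → Fin 3) (v : List Bool)
    (h : (MulAction.stabilizer (Equiv.Perm (List Bool)) v).relIndex (grigorchukGroup ω) ≠ 0) :
    2 ^ v.length ≤
      (MulAction.stabilizer (Equiv.Perm (List Bool)) v).relIndex (grigorchukGroup ω) := by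
  have hst : (MulAction.stabilizer (Equiv.Perm (List Bool)) v).relIndex (grigorchukGroup ω) =
      (MulAction.orbit (grigorchukGroup ω) v).ncard := by
    rw [← MulAction.index_stabilizer]
    rfl
  rw [hst] at h ⊢
  have hcard : {w : List Bool | w.length = v.length}.ncard = 2 ^ v.length := by
    have : Nat.card (List.Vector Bool v.length) = 2 ^ v.length := by
      rw [Nat.card_eq_fintype_card, card_vector, Fintype.card_bool]
    exact this
  rw [← hcard]
  refine Set.ncard_le_ncard (fun w hw => ?_) (Set.finite_of_ncard_ne_zero h)
  obtain ⟨g, hg, rfl⟩ := exists_apply_eq ω (Eq.symm hw)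
  exact ⟨⟨g, hg⟩, rfl⟩

/-- The factors y commute with each other and with the x of the other pair, so they cancel. -/
theorem commutator_mul_mul {G : Type*} [Group G] {x₁ x₂ y₁ y₂ : G} (h₁₂ : Commute x₁ y₂)
    (h₂₁ : Commute x₂ y₁) (h : Commute y₁ y₂) :
    x₁ * y₁ * (x₂ * y₂) * (x₁ * y₁)⁻¹ * (x₂ * y₂)⁻¹ = x₁ * x₂ * x₁⁻¹ * x₂⁻¹ := by
  have e₁ : x₁ * y₁ * (x₂ * y₂) = x₁ * x₂ * (y₁ * y₂) := h₂₁.symm.mul_mul_mul_comm _ _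
  have e₂ : x₂ * y₂ * (x₁ * y₁) = x₂ * x₁ * (y₁ * y₂) := by
    rw [h.eq]
    exact h₁₂.symm.mul_mul_mul_comm _ _
  rw [mul_assoc _ (x₁ * y₁)⁻¹, ← mul_inv_rev, e₁, e₂]
  group

/-- Below a vertex that is moved by `K`, the subgroup `K` contains finite index subgroups of the
rigid stabilizers of all vertices of a deep enough level. -/
theorem HasLargeProjections.exists_relIndex_ne_zero {ω : ℕ → Fin 3} (hω : EveryLetterOften ω)
    {K : Subgroup (Equiv.Perm (List Bool))} (hK : HasLargeProjections ω K)
    (hle : K ≤ grigorchukGroup ω) {g : Equiv.Perm (List Bool)} (hg : g ∈ K) {u : List Bool}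
    (hgu : g u ≠ u) :
    ∃ m, ∀ v : List Bool, v.length = m → (K.comap (cone (u ++ v))).relIndex
      (grigorchukGroup (shift^[(u ++ v).length] ω)) ≠ 0 := by
  obtain ⟨Q, hQ, hproj⟩ := hK g hg u hgu
  -- With 2ᵐ larger than the index of Q, every vertex of level m is moved by some element of Q.
  obtain ⟨m, hm⟩ := pow_unbounded_of_one_lt (Q.relIndex (grigorchukGroup (shift^[u.length] ω)))
    (one_lt_two : 1 < 2)
  have htree := hle.trans (grigorchukGroup_le_treeAut ω)
  refine ⟨m, fun v hv => ?_⟩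
  obtain ⟨x, hx, hxv⟩ : ∃ x ∈ Q, x v ≠ v := by
    by_contra! hcon
    have hQS : Q ≤ MulAction.stabilizer (Equiv.Perm (List Bool)) v := hcon
    have h0 := relIndex_ne_zero_of_le_left hQS hQ
    have h1 := two_pow_le_relIndex_stabilizer _ v h0
    have h2 := Nat.le_of_dvd (Nat.pos_of_ne_zero hQ) (Subgroup.relIndex_dvd_of_le_left _ hQS)
    rw [hv] at h1
    omega
  obtain ⟨y, hy, hw⟩ := hproj x hx
  -- V is moved by g to a vertex below g u, and by w to a different vertex below u. Hence V, g V and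
  -- w V are distinct and the auxiliary factors of lifts along g and along w have disjoint supports.
  set w := cone u x * y with hwdef
  set V := u ++ v with hV
  have hlen := length_apply (htree hg) u
  have hwV : w V = u ++ x v := by
    rw [hwdef, Equiv.Perm.mul_apply, hy V, hV, cone_apply_append]
    exact fun h => hgu (eq_of_prefix_of_prefix h (List.prefix_append _ _) hlen)
  have hgpre : g u <+: g V := (prefix_apply_iff (htree hg)).2 (List.prefix_append _ _)
  have hgV : g V ≠ V := fun h =>
    hgu (eq_of_prefix_of_prefix (h ▸ hgpre) (List.prefix_append _ _) hlen)
  have hwV' : w V ≠ V := fun h => hxv (by simpa [hV] using hwV.symm.trans h)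
  have hgw : g V ≠ w V := fun h =>
    hgu (eq_of_prefix_of_prefix (z := g V) hgpre (h ▸ hwV ▸ List.prefix_append _ _) hlen)
  obtain ⟨Q₁, hQ₁, hproj₁⟩ := hK g hg V hgV
  obtain ⟨Q₂, hQ₂, hproj₂⟩ := hK w hw V hwV'
  set N := grigorchukGroup (shift^[V.length] ω)
  have hQN : (Q₁ ⊓ Q₂ ⊓ N).relIndex N ≠ 0 :=
    Subgroup.relIndex_inf_ne_zero (Subgroup.relIndex_inf_ne_zero hQ₁ hQ₂) (by simp)
  refine relIndex_ne_zero_of_le_left ?_ (relIndex_commutator_ne_zero inf_le_right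
    (fun _ h => isOfFinOrder_of_mem (hω.iterate _) h) hQN)
  rw [Subgroup.commutator_le]
  rintro x₁ ⟨⟨hx₁, -⟩, -⟩ x₂ ⟨⟨-, hx₂⟩, -⟩
  obtain ⟨y₁, hy₁, hk₁⟩ := hproj₁ x₁ hx₁
  obtain ⟨y₂, hy₂, hk₂⟩ := hproj₂ x₂ hx₂
  have hlg := length_apply (htree hg) V
  have hlw := length_apply (htree hw) V
  -- The commutator of the two lifts is the commutator of x₁ and x₂ placed below V, with no
  -- auxiliary part left.
  have hc := commutator_mul_mul
    ((supportedBelow_cone V x₁).commute hy₂ hwV'.symm hlw.symm)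
    ((supportedBelow_cone V x₂).commute hy₁ hgV.symm hlg.symm)
    (hy₁.commute hy₂ hgw (hlg.trans hlw.symm))
  rw [Subgroup.mem_comap, commutatorElement_def, map_mul, map_mul, map_mul, map_inv, map_inv,
    ← hc]
  exact mul_mem (mul_mem (mul_mem hk₁ hk₂) (inv_mem hk₁)) (inv_mem hk₂)

end GrigorchukFamily

/-! ### Live vertices -/

namespace GrigorchukFamily
open InvariantRandomSubgroup

/-- A property of vertices holds for all but finitely many of the vertices below `u`. -/
def EventuallyBelow (S : List Bool → Prop) (u : List Bool) : Prop :=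
  ∃ k, ∀ w : List Bool, k ≤ w.length → S (u ++ w)

theorem EventuallyBelow.of_children {S : List Bool → Prop} {u : List Bool}
    (h : ∀ b, EventuallyBelow S (u ++ [b])) : EventuallyBelow S u := by
  obtain ⟨k₀, h₀⟩ := h false
  obtain ⟨k₁, h₁⟩ := h true
  refine ⟨max k₀ k₁ + 1, fun w hw => ?_⟩
  rcases w with _ | ⟨_ | _, w⟩
  · simp at hw
  · simpa using h₀ w (by simp at hw; omega)
  · simpa using h₁ w (by simp at hw; omega)

theorem EventuallyBelow.of_level {S : List Bool → Prop} {u : List Bool} (n : ℕ)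
    (h : ∀ w : List Bool, w.length = n → EventuallyBelow S (u ++ w)) : EventuallyBelow S u := by
  induction n generalizing u with
  | zero => simpa using h [] rfl
  | succ n ih => exact .of_children fun b => ih fun w hw => by simpa using h (b :: w) (by simp [hw])

theorem apply_eq_of_prefix {g : Equiv.Perm (List Bool)} (hg : g ∈ treeAut) {u z : List Bool}
    (hu : u <+: z) (hz : g z = z) : g u = u :=
  eq_of_prefix_of_prefix (hz ▸ (prefix_apply_iff hg).2 hu) hu (length_apply hg u)

/-- The vertex `u` is live for `K` if `K` fixes a point of the boundary of the tree below `u`: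
there are vertices below `u` at all distances that are fixed by `K`. -/
def Live (K : Subgroup (Equiv.Perm (List Bool))) (u : List Bool) : Prop :=
  ∀ n, ∃ w : List Bool, w.length = n ∧ ∀ g ∈ K, g (u ++ w) = u ++ w

theorem Live.apply_eq {K : Subgroup (Equiv.Perm (List Bool))} {u : List Bool} (h : Live K u)
    {g : Equiv.Perm (List Bool)} (hg : g ∈ K) : g u = u := by
  obtain ⟨w, hw, H⟩ := h 0
  obtain rfl := List.length_eq_zero_iff.1 hw
  simpa using H g hg

theorem Live.of_append {K : Subgroup (Equiv.Perm (List Bool))} (hK : K ≤ treeAut)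
    {u v : List Bool} (h : Live K (u ++ v)) : Live K u := by
  intro n
  obtain ⟨w, hw, H⟩ := h n
  refine ⟨(v ++ w).take n, by simp [hw], fun g hg => apply_eq_of_prefix (hK hg) ?_ (H g hg)⟩
  rw [List.append_assoc, List.prefix_append_right_inj]
  exact List.take_prefix _ _

/-- Compactness: if neither child were live, each would fail at some depth, and u would fail one
level below the larger depth. -/
theorem Live.exists_child {K : Subgroup (Equiv.Perm (List Bool))} (hK : K ≤ treeAut)
    {u : List Bool} (h : Live K u) : ∃ b, Live K (u ++ [b]) := by
  by_contra! hcon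
  simp only [Live, not_forall, not_exists, not_and] at hcon
  choose n hn using hcon
  obtain ⟨w, hw, H⟩ := h (max (n false) (n true) + 1)
  rcases w with _ | ⟨b, w⟩
  · simp at hw
  have hle : n b ≤ w.length := by
    simp at hw
    cases b <;> omega
  obtain ⟨g, hg, hne⟩ := hn b (w.take (n b)) (by simp [hle])
  refine hne (apply_eq_of_prefix (hK hg) ?_ (H g hg))
  rw [List.append_assoc, List.prefix_append_right_inj, List.singleton_append,
    List.cons_prefix_cons]
  exact ⟨rfl, List.take_prefix _ _⟩

theorem Live.exists_append {K : Subgroup (Equiv.Perm (List Bool))} (hK : K ≤ treeAut)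
    {u : List Bool} (h : Live K u) (n : ℕ) : ∃ w : List Bool, w.length = n ∧ Live K (u ++ w) := by
  induction n with
  | zero => exact ⟨[], rfl, by simpa using h⟩
  | succ n ih =>
    obtain ⟨w, hw, hl⟩ := ih
    obtain ⟨b, hb⟩ := hl.exists_child hK
    exact ⟨w ++ [b], by simp [hw], by simpa using hb⟩

/-- The permutation `g` fixes all live vertices. -/
def FixesLive (K : Subgroup (Equiv.Perm (List Bool))) (g : Equiv.Perm (List Bool)) : Prop :=
  ∀ u, Live K u → g u = u

theorem Live.map_conj {K : Subgroup (Equiv.Perm (List Bool))} {u : List Bool} (h : Live K u)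
    {g : Equiv.Perm (List Bool)} (hg : g ∈ treeAut) :
    Live (K.map (MulAut.conj g).toMonoidHom) (g u) := by
  intro n
  obtain ⟨w, hw, H⟩ := h n
  obtain ⟨w', hw'⟩ := (prefix_apply_iff hg).2 (List.prefix_append u w)
  refine ⟨w', ?_, ?_⟩
  · have := congrArg List.length hw'
    simp [length_apply hg, hw] at this
    exact this
  · rintro _ ⟨x, hx, rfl⟩
    rw [hw']
    have : g⁻¹ (g (u ++ w)) = u ++ w := g.symm_apply_apply _
    change g (x (g⁻¹ (g (u ++ w)))) = _
    rw [this, H x hx]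

variable {ω : ℕ → Fin 3}

theorem map_subtype_le_treeAut (H : Subgroup (grigorchukGroup ω)) :
    H.map (grigorchukGroup ω).subtype ≤ treeAut :=
  (Subgroup.map_subtype_le _).trans (grigorchukGroup_le_treeAut ω)

theorem map_subtype_map_conj (H : Subgroup (grigorchukGroup ω)) (g : grigorchukGroup ω) :
    (H.map (MulAut.conj g).toMonoidHom).map (grigorchukGroup ω).subtype =
      (H.map (grigorchukGroup ω).subtype).map (MulAut.conj g.1).toMonoidHom := by
  rw [Subgroup.map_map, Subgroup.map_map]
  rfl

theorem map_conj_inv_map_conj {G : Type*} [Group G] (K : Subgroup G) (g : G) :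
    (K.map (MulAut.conj g).toMonoidHom).map (MulAut.conj g⁻¹).toMonoidHom = K := by
  ext x
  rw [mem_map_conj, mem_map_conj]
  simp [mul_assoc]

theorem live_map_conj_iff (H : Subgroup (grigorchukGroup ω)) (g : grigorchukGroup ω)
    (u : List Bool) :
    Live ((H.map (MulAut.conj g).toMonoidHom).map (grigorchukGroup ω).subtype) (g.1 u) ↔
      Live (H.map (grigorchukGroup ω).subtype) u := by
  have hg := grigorchukGroup_le_treeAut ω g.2
  rw [map_subtype_map_conj]
  refine ⟨fun h => ?_, fun h => h.map_conj hg⟩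
  have := h.map_conj (inv_mem hg)
  rw [map_conj_inv_map_conj] at this
  have hu : (g.1⁻¹ : Equiv.Perm (List Bool)) (g.1 u) = u := g.1.symm_apply_apply u
  rwa [hu] at this

theorem measurable_live (u : List Bool) : Measurable fun H : Subgroup (grigorchukGroup ω) =>
    Live (H.map (grigorchukGroup ω).subtype) u := by
  have : ∀ H : Subgroup (grigorchukGroup ω), Live (H.map (grigorchukGroup ω).subtype) u ↔
      ∀ n, ∃ w : List Bool, w.length = n ∧ ∀ g : grigorchukGroup ω, g ∈ H →
        g.1 (u ++ w) = u ++ w := fun H => by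
    refine forall_congr' fun n => exists_congr fun w => and_congr_right fun _ => ?_
    simp [Subgroup.mem_map]
  simp only [this]
  exact Measurable.forall fun n => Measurable.exists fun w => measurable_const.and
    (Measurable.forall fun g => (measurable_mem g).imp measurable_const)

/-- Transitivity on levels combined with conjugation invariance. -/
theorem measure_live_eq {μ : ProbabilityMeasure (Subgroup (grigorchukGroup ω))} (hμ : IsIRS μ)
    {u v : List Bool} (h : u.length = v.length) :
    (μ : Measure (Subgroup (grigorchukGroup ω)))
        {H | Live (H.map (grigorchukGroup ω).subtype) u} =
      (μ : Measure (Subgroup (grigorchukGroup ω)))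
        {H | Live (H.map (grigorchukGroup ω).subtype) v} := by
  obtain ⟨g, hg, rfl⟩ := exists_apply_eq ω h
  rw [← (hμ ⟨g, hg⟩).measure_preimage
    (measurableSet_setOfPred.2 (measurable_live (g u))).nullMeasurableSet]
  congr 1
  ext H
  exact (live_map_conj_iff H ⟨g, hg⟩ u).symm

theorem shift_iterate_apply (n j : ℕ) : (shift^[n] ω) j = ω (n + j) := by
  induction n generalizing ω with
  | zero => simp
  | succ n ih =>
    rw [Function.iterate_succ_apply, ih, shift]
    congr 1
    omega

theorem directed_replicate (x : Klein) (j : ℕ) (w : List Bool) :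
    directed x ω (List.replicate j true ++ false :: w) =
      List.replicate j true ++ false :: powA (letterHom (ω j) x) w := by
  induction j generalizing ω with
  | zero => simp
  | succ j ih => simp [List.replicate_succ, ih, shift]

theorem exists_letterHom_apply_ne_zero {x : Klein} (hx : x ≠ 0) : ∃ i, letterHom i x ≠ 0 := by
  rcases klein_cases x with rfl | rfl | rfl | rfl
  exacts [(hx rfl).elim, ⟨0, by decide⟩, ⟨0, by decide⟩, ⟨1, by decide⟩]

/-- On the exceptional event v1ʲ is live for all j. Whenever the letter at v1ʲ0 does not kill x,
that event costs a fixed amount in the passage from the probability of liveness at one level to the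
next, which a convergent sequence cannot afford infinitely often. -/
theorem ae_exists_not_live (hω : EveryLetterOften ω)
    {μ : ProbabilityMeasure (Subgroup (grigorchukGroup ω))} (hμ : IsIRS μ)
    {g : Equiv.Perm (List Bool)} {v : List Bool} {x : Klein} (hx : x ≠ 0)
    (hg : ∀ w, g (v ++ w) = v ++ directed x (shift^[v.length] ω) w) :
    ∀ᵐ H ∂(μ : Measure (Subgroup (grigorchukGroup ω))),
      FixesLive (H.map (grigorchukGroup ω).subtype) g →
        ∃ k, ¬ Live (H.map (grigorchukGroup ω).subtype) (v ++ List.replicate k true) := by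
  set m := (μ : Measure (Subgroup (grigorchukGroup ω))) with hm
  have : IsProbabilityMeasure m := inferInstanceAs (IsProbabilityMeasure μ.toMeasure)
  set L : List Bool → Set (Subgroup (grigorchukGroup ω)) :=
    fun u => {H | Live (H.map (grigorchukGroup ω).subtype) u} with hL
  let p : ℕ → ENNReal := fun n => m (L (List.replicate n true))
  have hp : ∀ u, m (L u) = p u.length := fun u => measure_live_eq hμ (by simp)
  have hanti : Antitone p := antitone_nat_of_succ_le fun n => by
    refine measure_mono fun H hH => ?_
    rw [hL, Set.mem_ofPred_eq, List.replicate_succ'] at hH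
    exact hH.of_append (map_subtype_le_treeAut H)
  obtain ⟨l, hl⟩ : ∃ l, Tendsto p atTop (𝓝 l) := ⟨_, tendsto_atTop_iInf hanti⟩
  have hlt : l ≠ ⊤ := ne_top_of_le_ne_top ENNReal.one_ne_top
    (le_of_tendsto' hl fun n => prob_le_one)
  rw [ae_iff]
  set E := {H : Subgroup (grigorchukGroup ω) |
    ¬ (FixesLive (H.map (grigorchukGroup ω).subtype) g →
      ∃ k, ¬ Live (H.map (grigorchukGroup ω).subtype) (v ++ List.replicate k true))} with hE
  -- On E the vertex v1ʲ is live, but v1ʲ0 is not: g swaps its two children, while one child of a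
  -- live vertex is live and hence fixed by g. So E and the liveness of v1ʲ0 are disjoint parts of
  -- the liveness of v1ʲ.
  have hstep : ∀ j, letterHom (ω (v.length + j)) x ≠ 0 →
      m E + p (v.length + j + 1) ≤ p (v.length + j) := by
    intro j hj
    have h1 : p (v.length + j) = m (L (v ++ List.replicate j true)) := by simp [hp]
    have h2 : p (v.length + j + 1) = m (L (v ++ List.replicate j true ++ [false])) := by
      simp [hp, add_assoc]
    rw [h1, h2, ← measure_union ?_ (measurableSet_setOfPred.2 (measurable_live _))]
    · refine measure_mono (Set.union_subset (fun H hH => ?_) fun H hH => ?_)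
      · rw [hE, Set.mem_ofPred_eq] at hH
        push Not at hH
        exact hH.2 j
      · exact Live.of_append (map_subtype_le_treeAut H) hH
    · refine Set.disjoint_left.2 fun H hH hH' => ?_
      rw [hE, Set.mem_ofPred_eq] at hH
      push Not at hH
      obtain ⟨b, hb⟩ := Live.exists_child (map_subtype_le_treeAut H) hH'
      have := hH.1 _ hb
      rw [List.append_assoc, List.append_assoc, List.singleton_append, hg, directed_replicate,
        shift_iterate_apply, powA_of_ne hj] at this
      simp at this
  obtain ⟨i, hi⟩ := exists_letterHom_apply_ne_zero hx
  have hfreq : ∃ᶠ n in atTop, m E + p (n + 1) ≤ p n := by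
    refine frequently_atTop.2 fun N => ?_
    obtain ⟨n, hn, rfl⟩ := hω i (max N v.length)
    refine ⟨n, (le_max_left _ _).trans hn, ?_⟩
    obtain ⟨j, rfl⟩ := Nat.exists_eq_add_of_le ((le_max_right _ _).trans hn)
    exact hstep j hi
  have hlim : m E + l ≤ l := le_of_tendsto_of_tendsto_of_frequently
    (tendsto_const_nhds.add (hl.comp (tendsto_add_atTop_nat 1))) hl hfreq
  have := ENNReal.le_sub_of_add_le_right hlt hlim
  simpa using this

/-! ### Contraction to the generators, and triviality of germs -/

/-- The generators of `G_ω` together with the identity. -/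
def nucleus (ω : ℕ → Fin 3) : Set (Equiv.Perm (List Bool)) :=
  insert genA (Set.range fun x => directed x ω)

theorem powA_mem_nucleus (e : ZMod 2) : powA e ∈ nucleus ω := by
  by_cases h : e = 0
  · exact .inr ⟨0, by simp [h]⟩
  · exact .inl (powA_of_ne h)

/-- One level absorbs one multiplication: a is involutive with trivial sections, and two Klein
letters merge. -/
theorem exists_section_mem_nucleus {s t : Equiv.Perm (List Bool)} (hs : s ∈ nucleus ω)
    (ht : t ∈ nucleus ω) (b : Bool) :
    ∃ c, ∃ r ∈ nucleus (shift ω), ∀ w, s (t (b :: w)) = c :: r w := by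
  have hdir : ∀ (x : Klein) b, ∃ r ∈ nucleus (shift ω), ∀ w, directed x ω (b :: w) = b :: r w := by
    rintro x (_ | _)
    exacts [⟨_, powA_mem_nucleus _, directed_cons_false x ω⟩, ⟨_, .inr ⟨x, rfl⟩, fun w => rfl⟩]
  rcases hs with rfl | ⟨x, rfl⟩ <;> rcases ht with rfl | ⟨y, rfl⟩
  · exact ⟨b, 1, .inr ⟨0, by simp⟩, by simp⟩
  · obtain ⟨r, hr, h⟩ := hdir y b
    exact ⟨!b, r, hr, by simp [h]⟩
  · obtain ⟨r, hr, h⟩ := hdir x (!b)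
    exact ⟨!b, r, hr, by simp [h]⟩
  · obtain ⟨r, hr, h⟩ := hdir (x + y) b
    exact ⟨b, r, hr, fun w => by rw [← h, directed_add, Equiv.Perm.mul_apply]⟩

/-- The sections of `g` at the vertices of level `n` belong to the nucleus. -/
def HasNuclearSections (ω : ℕ → Fin 3) (n : ℕ) (g : Equiv.Perm (List Bool)) : Prop :=
  ∀ u : List Bool, u.length = n → ∃ u' : List Bool, u'.length = n ∧
    ∃ s ∈ nucleus (shift^[n] ω), ∀ w, g (u ++ w) = u' ++ s w

theorem HasNuclearSections.mul {n : ℕ} {g h : Equiv.Perm (List Bool)}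
    (hg : HasNuclearSections ω n g) (hh : HasNuclearSections ω n h) :
    HasNuclearSections ω (n + 1) (g * h) := by
  intro u hu
  obtain ⟨v, b, rfl⟩ : ∃ v b, u = v ++ [b] := by
    rcases List.eq_nil_or_concat u with rfl | ⟨v, b, rfl⟩
    · simp at hu
    · exact ⟨v, b, by simp⟩
  obtain ⟨v', hv', t, ht, H⟩ := hh v (by simpa using hu)
  obtain ⟨v'', hv'', s, hs, H'⟩ := hg v' hv'
  obtain ⟨c, r, hr, H''⟩ := exists_section_mem_nucleus hs ht b
  refine ⟨v'' ++ [c], by simp [hv''], r, ?_, fun w => ?_⟩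
  · rwa [Function.iterate_succ_apply']
  · rw [Equiv.Perm.mul_apply, List.append_assoc, H, H', List.singleton_append, H'']
    simp

theorem HasNuclearSections.one (n : ℕ) : HasNuclearSections ω n 1 :=
  fun u hu => ⟨u, hu, 1, .inr ⟨0, by simp⟩, fun _ => rfl⟩

theorem HasNuclearSections.of_mem {s : Equiv.Perm (List Bool)} (hs : s ∈ nucleus ω) (n : ℕ) :
    HasNuclearSections ω n s := by
  induction n with
  | zero =>
    intro u hu
    obtain rfl := List.length_eq_zero_iff.1 hu
    exact ⟨[], rfl, s, hs, fun _ => rfl⟩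
  | succ n ih => simpa using ih.mul (.one n)

theorem exists_hasNuclearSections {g : Equiv.Perm (List Bool)} (hg : g ∈ grigorchukGroup ω) :
    ∃ n, HasNuclearSections ω n g := by
  induction hg using grigorchukGroup_induction with
  | one => exact ⟨0, .one 0⟩
  | genA_mul g _ ih =>
    obtain ⟨n, hn⟩ := ih
    exact ⟨n + 1, (HasNuclearSections.of_mem (.inl rfl) n).mul hn⟩
  | directed_mul x g _ ih =>
    obtain ⟨n, hn⟩ := ih
    exact ⟨n + 1, (HasNuclearSections.of_mem (.inr ⟨x, rfl⟩) n).mul hn⟩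

/-- Germs of elements that fix the live vertices are trivial at the points of the boundary that
`K` fixes. -/
def HasTrivialGerms (ω : ℕ → Fin 3) (K : Subgroup (Equiv.Perm (List Bool))) : Prop :=
  ∀ g ∈ grigorchukGroup ω, FixesLive K g → ∀ (v : List Bool) (x : Klein), x ≠ 0 →
    (∀ w, g (v ++ w) = v ++ directed x (shift^[v.length] ω) w) →
      ∃ k, ¬ Live K (v ++ List.replicate k true)

theorem ae_hasTrivialGerms (hω : EveryLetterOften ω)
    {μ : ProbabilityMeasure (Subgroup (grigorchukGroup ω))} (hμ : IsIRS μ) :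
    ∀ᵐ H ∂(μ : Measure (Subgroup (grigorchukGroup ω))),
      HasTrivialGerms ω (H.map (grigorchukGroup ω).subtype) := by
  have : ∀ᵐ H ∂(μ : Measure (Subgroup (grigorchukGroup ω))), ∀ (g : grigorchukGroup ω)
      (v : List Bool) (x : Klein), x ≠ 0 →
      (∀ w, g.1 (v ++ w) = v ++ directed x (shift^[v.length] ω) w) →
      FixesLive (H.map (grigorchukGroup ω).subtype) g →
        ∃ k, ¬ Live (H.map (grigorchukGroup ω).subtype) (v ++ List.replicate k true) := by
    refine ae_all_iff.2 fun g => ae_all_iff.2 fun v => ae_all_iff.2 fun x => ae_all_iff.2 fun hx =>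
      ae_all_iff.2 fun hg => ae_exists_not_live hω hμ hx hg
  filter_upwards [this] with H hH g hg hfix v x hx h
  exact hH ⟨g, hg⟩ v x hx h hfix

/-- The permutation `g` fixes all words below `u`. -/
def FixesBelow (g : Equiv.Perm (List Bool)) (u : List Bool) : Prop := ∀ w, g (u ++ w) = u ++ w

/-- At a deep level the section of g at a live vertex is a generator or trivial. It is not a, which
would move a live child. If it is some x ≠ 0, the ray u1ᵏ stops being live by hypothesis, and only
finitely many branches off the ray remain. -/
theorem HasTrivialGerms.eventuallyBelow {K : Subgroup (Equiv.Perm (List Bool))}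
    (hK : HasTrivialGerms ω K) (hle : K ≤ treeAut) {g : Equiv.Perm (List Bool)}
    (hg : g ∈ grigorchukGroup ω) (hfix : FixesLive K g) :
    EventuallyBelow (fun u => Live K u → FixesBelow g u) [] := by
  have hdead : ∀ u, ¬ Live K u → EventuallyBelow (fun u => Live K u → FixesBelow g u) u :=
    fun u hu => ⟨0, fun w _ hl => (hu (hl.of_append hle)).elim⟩
  have htriv : ∀ u, FixesBelow g u → EventuallyBelow (fun u => Live K u → FixesBelow g u) u :=
    fun u hu => ⟨0, fun w _ _ z => by simpa using hu (w ++ z)⟩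
  have hswap : ∀ u, (∀ w, g (u ++ w) = u ++ genA w) → ¬ Live K u := by
    intro u hu hl
    obtain ⟨b, hb⟩ := hl.exists_child hle
    simpa [hu] using hfix _ hb
  -- Induction along the ray: at each step the branch to the first child has trivial section, or
  -- section a and is then not live.
  have hdir : ∀ (x : Klein) k (ω' : ℕ → Fin 3) u, (∀ w, g (u ++ w) = u ++ directed x ω' w) →
      ¬ Live K (u ++ List.replicate k true) →
        EventuallyBelow (fun u => Live K u → FixesBelow g u) u := by
    intro x k
    induction k with
    | zero => exact fun ω' u _ h => hdead u (by simpa using h)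
    | succ k ih =>
      intro ω' u hu h
      refine .of_children fun b => ?_
      cases b
      · by_cases he : letterHom (ω' 0) x = 0
        · exact htriv _ fun w => by simp [hu, he]
        · exact hdead _ (hswap _ fun w => by simp [hu, powA_of_ne he])
      · exact ih (shift ω') _ (fun w => by simp [hu]) (by simpa [List.replicate_succ] using h)
  obtain ⟨n, hn⟩ := exists_hasNuclearSections hg
  refine .of_level n fun u hu => ?_
  rw [List.nil_append]
  by_cases hl : Live K u
  · obtain ⟨u', hu', s, hs, H⟩ := hn u hu
    have hs0 : s [] = [] := by
      rcases hs with rfl | ⟨x, rfl⟩ <;> simp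
    obtain rfl : u' = u := by
      have := hfix u hl
      have h2 := H []
      rw [hs0, List.append_nil, List.append_nil] at h2
      exact h2.symm.trans this
    rcases hs with rfl | ⟨x, rfl⟩
    · exact (hswap u' H hl).elim
    · by_cases hx : x = 0
      · exact htriv _ fun w => by simp [H, hx]
      · rw [← hu] at H
        obtain ⟨k, hk⟩ := hK g hg hfix u' x hx H
        exact hdir x k _ u' H hk
  · exact hdead u hl

end GrigorchukFamily

/-! ### The finite index approximations -/

namespace GrigorchukFamily
open InvariantRandomSubgroup

variable {ω : ℕ → Fin 3}

/-- The permutation fixes everything below the live vertices of level `n`. -/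
def FixesBelowLive (n : ℕ) (K : Subgroup (Equiv.Perm (List Bool)))
    (g : Equiv.Perm (List Bool)) : Prop :=
  ∀ u : List Bool, u.length = n → Live K u → FixesBelow g u

/-- The permutation fixes level `n`, and everything below the vertices of this level that are not
live. -/
def FixesBelowDead (n : ℕ) (K : Subgroup (Equiv.Perm (List Bool)))
    (g : Equiv.Perm (List Bool)) : Prop :=
  ∀ u : List Bool, u.length = n → g u = u ∧ (¬ Live K u → FixesBelow g u)

theorem FixesBelow.mul {g h : Equiv.Perm (List Bool)} {u : List Bool} (hg : FixesBelow g u)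
    (hh : FixesBelow h u) : FixesBelow (g * h) u :=
  fun w => by rw [Equiv.Perm.mul_apply, hh, hg]

theorem FixesBelow.inv {g : Equiv.Perm (List Bool)} {u : List Bool} (hg : FixesBelow g u) :
    FixesBelow g⁻¹ u :=
  fun w => Equiv.Perm.inv_eq_iff_eq.2 (hg w).symm

theorem apply_eq_of_length_le {g : Equiv.Perm (List Bool)} (hg : g ∈ treeAut) {n : ℕ}
    (h : ∀ u : List Bool, u.length = n → g u = u) {z : List Bool} (hz : z.length ≤ n) :
    g z = z :=
  apply_eq_of_prefix hg (List.prefix_append z (List.replicate (n - z.length) true))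
    (h _ (by simp; omega))

theorem apply_eq_of_fixesBelow {g : Equiv.Perm (List Bool)} {n : ℕ} {z : List Bool}
    (h : FixesBelow g (z.take n)) : g z = z := by
  have := h (z.drop n)
  rwa [List.take_append_drop] at this

/-- Disjoint supports: h moves nothing below live vertices, and s moves nothing elsewhere. This
makes the set of products h s a group. -/
theorem commute_of_fixesBelow {n : ℕ} {K : Subgroup (Equiv.Perm (List Bool))}
    {h s : Equiv.Perm (List Bool)} (hs : s ∈ treeAut) (h₁ : FixesBelowLive n K h)
    (h₂ : FixesBelowDead n K s) : Commute h s := by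
  refine Equiv.Perm.Disjoint.commute fun z => ?_
  rcases le_or_gt n z.length with hz | hz
  · by_cases hl : Live K (z.take n)
    · exact .inl (apply_eq_of_fixesBelow (h₁ _ (by simp [hz]) hl))
    · exact .inr (apply_eq_of_fixesBelow ((h₂ _ (by simp [hz])).2 hl))
  · exact .inr (apply_eq_of_length_le hs (fun u hu => (h₂ u hu).1) hz.le)

/-- The approximation of `H` at level `n`: the group generated by the elements of `H` that act
trivially below the live vertices of level `n` and by the elements of `G_ω` that fix level `n` and
act trivially below the other vertices of this level. -/
def levelApprox (n : ℕ) (H : Subgroup (grigorchukGroup ω)) : Subgroup (grigorchukGroup ω) where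
  carrier := {g | ∃ h s : grigorchukGroup ω, h ∈ H ∧ g = h * s ∧
    FixesBelowLive n (H.map (grigorchukGroup ω).subtype) h ∧
    FixesBelowDead n (H.map (grigorchukGroup ω).subtype) s}
  one_mem' := ⟨1, 1, one_mem _, by simp, fun _ _ _ _ => rfl, fun _ _ => ⟨rfl, fun _ _ => rfl⟩⟩
  mul_mem' := by
    rintro _ _ ⟨h, s, hH, rfl, h₁, h₂⟩ ⟨h', s', hH', rfl, h₁', h₂'⟩
    refine ⟨h * h', s * s', mul_mem hH hH', ?_, fun u hu hl => (h₁ u hu hl).mul (h₁' u hu hl),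
      fun u hu => ⟨?_, fun hl => ((h₂ u hu).2 hl).mul ((h₂' u hu).2 hl)⟩⟩
    · have : Commute h' s :=
        Subtype.ext (commute_of_fixesBelow (grigorchukGroup_le_treeAut ω s.2) h₁' h₂)
      exact this.symm.mul_mul_mul_comm _ _
    · change s.1 (s'.1 u) = u
      rw [(h₂' u hu).1, (h₂ u hu).1]
  inv_mem' := by
    rintro _ ⟨h, s, hH, rfl, h₁, h₂⟩
    refine ⟨h⁻¹, s⁻¹, inv_mem hH, ?_, fun u hu hl => (h₁ u hu hl).inv,
      fun u hu => ⟨?_, fun hl => ((h₂ u hu).2 hl).inv⟩⟩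
    · have : Commute h s :=
        Subtype.ext (commute_of_fixesBelow (grigorchukGroup_le_treeAut ω s.2) h₁ h₂)
      rw [this.eq, mul_inv_rev]
    · exact Equiv.Perm.inv_eq_iff_eq.2 (h₂ u hu).1.symm

theorem measurable_levelApprox (n : ℕ) :
    Measurable (levelApprox n : Subgroup (grigorchukGroup ω) → _) := by
  refine measurable_of_mem fun g => Measurable.exists fun h => Measurable.exists fun s =>
    (measurable_mem h).and (measurable_const.and (Measurable.and ?_ ?_))
  · exact Measurable.forall fun u => measurable_const.imp
      ((measurable_live u).imp measurable_const)
  · exact Measurable.forall fun u => measurable_const.imp (measurable_const.and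
      ((measurable_live u).not.imp measurable_const))

theorem FixesBelow.conj {g k : Equiv.Perm (List Bool)} (hk : k ∈ treeAut) {u : List Bool}
    (hg : FixesBelow g u) : FixesBelow (k * g * k⁻¹) (k u) := by
  intro w
  obtain ⟨z, hz⟩ := k.surjective (k u ++ w)
  obtain ⟨w', rfl⟩ := (prefix_apply_iff hk).1 (hz ▸ List.prefix_append _ _)
  have : k⁻¹ (k (u ++ w')) = u ++ w' := k.symm_apply_apply _
  rw [← hz, Equiv.Perm.mul_apply, Equiv.Perm.mul_apply, this, hg]

theorem conj_mem_levelApprox {n : ℕ} {H : Subgroup (grigorchukGroup ω)} (k : grigorchukGroup ω)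
    {g : grigorchukGroup ω} (hg : g ∈ levelApprox n H) :
    k * g * k⁻¹ ∈ levelApprox n (H.map (MulAut.conj k).toMonoidHom) := by
  obtain ⟨h, s, hH, rfl, h₁, h₂⟩ := hg
  have hk := grigorchukGroup_le_treeAut ω k.2
  refine ⟨k * h * k⁻¹, k * s * k⁻¹, ⟨h, hH, rfl⟩, by group, fun u hu hl => ?_,
    fun u hu => ⟨?_, fun hl => ?_⟩⟩
  all_goals
    obtain ⟨u, rfl⟩ := k.1.surjective u
    rw [length_apply hk] at hu
  · exact (h₁ u hu ((live_map_conj_iff H k u).1 hl)).conj hk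
  · have : k.1⁻¹ (k.1 u) = u := k.1.symm_apply_apply _
    change k.1 (s.1 (k.1⁻¹ (k.1 u))) = _
    rw [this, (h₂ u hu).1]
  · exact ((h₂ u hu).2 fun h => hl ((live_map_conj_iff H k u).2 h)).conj hk

theorem levelApprox_map_conj (n : ℕ) (k : grigorchukGroup ω) (H : Subgroup (grigorchukGroup ω)) :
    levelApprox n (H.map (MulAut.conj k).toMonoidHom) =
      (levelApprox n H).map (MulAut.conj k).toMonoidHom := by
  ext g
  rw [mem_map_conj]
  constructor
  · intro h
    have := conj_mem_levelApprox k⁻¹ h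
    rwa [map_conj_inv_map_conj, inv_inv] at this
  · intro h
    have := conj_mem_levelApprox k h
    simpa [mul_assoc] using this

/-- The subgroup `K` contains a finite index subgroup of the rigid stabilizer of `u`. -/
def IsLargeBelow (ω : ℕ → Fin 3) (K : Subgroup (Equiv.Perm (List Bool))) (u : List Bool) : Prop :=
  (K.comap (cone u)).relIndex (grigorchukGroup (shift^[u.length] ω)) ≠ 0

theorem cone_append (u v : List Bool) : cone (u ++ v) = (cone u).comp (cone v) := by
  induction u with
  | nil => rfl
  | cons b u ih => rw [List.cons_append, cone, cone, ih, MonoidHom.comp_assoc]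

theorem IsLargeBelow.append (hω : EveryLetterOften ω) {K : Subgroup (Equiv.Perm (List Bool))}
    {u : List Bool} (h : IsLargeBelow ω K u) (v : List Bool) : IsLargeBelow ω K (u ++ v) := by
  rw [IsLargeBelow, cone_append, ← Subgroup.comap_comap, List.length_append, add_comm,
    Function.iterate_add_apply]
  exact Subgroup.relIndex_ne_zero_trans (Subgroup.relIndex_comap_ne_zero _ h)
    (relIndex_comap_cone_ne_zero (hω.iterate _) v)

/-- If u is not live, then at some depth below u every vertex is moved by K, and the commutator
trick applies to each of the finitely many. -/
theorem HasLargeProjections.eventuallyBelow (hω : EveryLetterOften ω)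
    {K : Subgroup (Equiv.Perm (List Bool))} (hK : HasLargeProjections ω K)
    (hle : K ≤ grigorchukGroup ω) {u : List Bool} (hu : ¬ Live K u) :
    EventuallyBelow (IsLargeBelow ω K) u := by
  simp only [Live, not_forall, not_exists, not_and] at hu
  obtain ⟨k, hk⟩ := hu
  refine .of_level k fun w hw => ?_
  obtain ⟨g, hg, hne⟩ := hk w hw
  obtain ⟨m, hm⟩ := hK.exists_relIndex_ne_zero hω hle hg hne
  refine .of_level m fun v hv => ⟨0, fun z _ => ?_⟩
  exact IsLargeBelow.append hω (hm v hv) z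

/-- For deep v, look at its ancestor of level n. If that is live, the whole rigid stabilizer of v
consists of admissible factors s; if not, H itself supplies a finite index subgroup of admissible
factors h. -/
theorem finiteIndex_levelApprox (hω : EveryLetterOften ω) (n : ℕ)
    {H : Subgroup (grigorchukGroup ω)}
    (hH : HasLargeProjections ω (H.map (grigorchukGroup ω).subtype)) :
    (levelApprox n H).FiniteIndex := by
  set K := H.map (grigorchukGroup ω).subtype with hKdef
  have hle : K ≤ grigorchukGroup ω := Subgroup.map_subtype_le _
  obtain ⟨k, hk⟩ : EventuallyBelow (fun z => ¬ Live K (z.take n) → IsLargeBelow ω K z) [] := by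
    refine .of_level n fun u hu => ?_
    by_cases hl : Live K u
    · exact ⟨0, fun w _ h => (h (by simpa [← hu] using hl)).elim⟩
    · obtain ⟨k, hk⟩ := hH.eventuallyBelow hω hle hl
      exact ⟨k, fun w hw _ => hk w hw⟩
  suffices h : ((levelApprox n H).map (grigorchukGroup ω).subtype).relIndex
      (grigorchukGroup ω) ≠ 0 by
    refine ⟨?_⟩
    rwa [← Subgroup.relIndex_top_right, ← Subgroup.relIndex_map_map_of_injective _ _
      (Subgroup.subtype_injective _), ← MonoidHom.range_eq_map, Subgroup.range_subtype]
  -- Depth at least n + 1 ensures that `cone v x` fixes level n for every permutation x, even one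
  -- that moves the empty word.
  refine relIndex_ne_zero_of_cone (max k (n + 1)) fun v hv => ?_
  have hkv : k ≤ v.length := hv ▸ le_max_left _ _
  have hnv : n + 1 ≤ v.length := hv ▸ le_max_right _ _
  have hfix : ∀ (x : Equiv.Perm (List Bool)) (u : List Bool), u.length = n → u ≠ v.take n →
      FixesBelow (cone v x) u := by
    intro x u hu hne w
    refine cone_apply_of_not_prefix (fun h => hne ?_) x
    exact eq_of_prefix_of_prefix (List.prefix_append u w) ((List.take_prefix n v).trans h)
      (by simp; omega)
  have hlev : ∀ (x : Equiv.Perm (List Bool)) (u : List Bool), u.length = n → cone v x u = u :=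
    fun x u hu => cone_apply_of_not_prefix (fun h => by have := h.length_le; omega) x
  rw [← hv]
  by_cases hl : Live K (v.take n)
  · refine relIndex_ne_zero_of_le_left (fun x hx => ?_) (relIndex_comap_cone_ne_zero hω v)
    refine ⟨⟨cone v x, hx⟩, ⟨1, _, one_mem _, (one_mul _).symm, fun _ _ _ _ => rfl,
      fun u hu => ⟨hlev x u hu, fun hd => hfix x u hu ?_⟩⟩, rfl⟩
    rintro rfl
    exact hd hl
  · refine relIndex_ne_zero_of_le_left (fun x hx => ?_) (hk v hkv (by simpa using hl))
    obtain ⟨h, hh, hhx⟩ := Subgroup.mem_comap.1 hx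
    refine ⟨h, ⟨h, 1, hh, (mul_one _).symm, fun u hu hlu => ?_,
      fun u hu => ⟨rfl, fun _ _ => rfl⟩⟩, hhx⟩
    have : h.1 = cone v x := hhx
    rw [this]
    refine hfix x u hu ?_
    rintro rfl
    exact hl hlu

/-- If g fixes all live vertices, it is trivial below those of deep levels; then in g = h s the
factor s is trivial everywhere, so g ∈ H. If g moves a live vertex u, it lies neither in H nor in
approximations at levels from that of u on, since h and s both fix a live vertex of level n below u.
-/
theorem tendsto_levelApprox {H : Subgroup (grigorchukGroup ω)}
    (hH : HasTrivialGerms ω (H.map (grigorchukGroup ω).subtype)) :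
    Tendsto (fun n => levelApprox n H) atTop (𝓝 H) := by
  set K := H.map (grigorchukGroup ω).subtype with hKdef
  have hle : K ≤ treeAut := map_subtype_le_treeAut H
  refine tendsto_of_eventually_mem fun g => ?_
  by_cases hfix : FixesLive K g
  · obtain ⟨k, hk⟩ := hH.eventuallyBelow hle g.2 hfix
    filter_upwards [eventually_ge_atTop k] with n hn
    have hlive : FixesBelowLive n K g := fun u hu hl => hk u (by simpa [hu] using hn) hl
    constructor
    · rintro ⟨h, s, hh, hg, h₁, h₂⟩
      have hs : s = h⁻¹ * g := by rw [hg, inv_mul_cancel_left]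
      have hs1 : s = 1 := by
        refine Subtype.ext (Equiv.ext fun z => ?_)
        rcases le_or_gt n z.length with hz | hz
        · refine apply_eq_of_fixesBelow (n := n) ?_
          by_cases hl : Live K (z.take n)
          · rw [hs]
            exact (h₁ _ (by simp [hz]) hl).inv.mul (hlive _ (by simp [hz]) hl)
          · exact (h₂ _ (by simp [hz])).2 hl
        · exact apply_eq_of_length_le (grigorchukGroup_le_treeAut ω s.2)
            (fun u hu => (h₂ u hu).1) hz.le
      rwa [hg, hs1, mul_one]
    · intro h
      exact ⟨g, 1, h, (mul_one _).symm, hlive, fun _ _ => ⟨rfl, fun _ _ => rfl⟩⟩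
  · simp only [FixesLive, not_forall] at hfix
    obtain ⟨u, hu, hne⟩ := hfix
    filter_upwards [eventually_ge_atTop u.length] with n hn
    constructor
    · rintro ⟨h, s, -, rfl, h₁, h₂⟩
      obtain ⟨w, hw, hl⟩ := hu.exists_append hle (n - u.length)
      have hlen : (u ++ w).length = n := by simp [hw]; omega
      refine (hne (apply_eq_of_prefix (grigorchukGroup_le_treeAut ω (h * s).2)
        (List.prefix_append u w) ?_)).elim
      change h.1 (s.1 (u ++ w)) = _
      rw [(h₂ _ hlen).1]
      simpa using h₁ _ hlen hl []
    · exact fun h => (hne (hu.apply_eq ⟨g, h, rfl⟩)).elim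

theorem isCosofic_of_isIRS (hω : EveryLetterOften ω)
    {μ : ProbabilityMeasure (Subgroup (grigorchukGroup ω))} (hμ : IsIRS μ) : IsCosofic μ := by
  refine hμ.isCosofic_of_tendsto levelApprox measurable_levelApprox levelApprox_map_conj
    (fun n => ?_) ?_
  · filter_upwards [ae_hasLargeProjections hω hμ] with H hH
    exact finiteIndex_levelApprox hω n hH
  · filter_upwards [ae_hasTrivialGerms hω hμ] with H hH
    exact tendsto_levelApprox hH

theorem everyLetterOften_of_mem_blockSequences (hω : ω ∈ blockSequences) :
    EveryLetterOften ω := by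
  obtain ⟨k, hk⟩ := hω
  intro x N
  obtain ⟨j, hj, h⟩ := hk N x
  exact ⟨k * N + j, (Nat.le_mul_of_pos_left N (by omega)).trans (Nat.le_add_right _ _), h⟩

/-! ### Uncountably many block sequences -/

/-- The sequence of the blocks `0, 1, 2, f i`. -/
def blockSequence (f : ℕ → Bool) (n : ℕ) : Fin 3 :=
  if n % 4 = 0 then 0 else if n % 4 = 1 then 1 else if n % 4 = 2 then 2 else
    if f (n / 4) then 1 else 0

theorem blockSequence_mem (f : ℕ → Bool) : blockSequence f ∈ blockSequences := by
  refine ⟨4, fun i x => ⟨x, by omega, ?_⟩⟩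
  fin_cases x <;> simp [blockSequence, Nat.add_mod]

theorem blockSequence_injective : Function.Injective blockSequence := by
  intro f g h
  funext i
  have := congrFun h (4 * i + 3)
  have h1 : (4 * i + 3) % 4 = 3 := by omega
  have h2 : (4 * i + 3) / 4 = i := by omega
  simp only [blockSequence, h1, h2] at this
  cases hf : f i <;> cases hg : g i <;> simp_all

theorem not_countable_blockSequences : ¬ blockSequences.Countable := by
  intro h
  have := h.to_subtype
  have hinj : Function.Injective fun f : ℕ → Bool =>
      (⟨blockSequence f, blockSequence_mem f⟩ : blockSequences) :=
    fun f g hfg => blockSequence_injective (congrArg Subtype.val hfg)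
  have := hinj.countable
  obtain ⟨e, he⟩ := exists_injective_nat (ℕ → Bool)
  classical
  refine Function.cantor_injective (fun s : Set ℕ => e fun n => decide (n ∈ s)) fun s t hst => ?_
  ext n
  simpa using congrFun (he hst) n

end GrigorchukFamily

theorem mainTheorem11 :
    ¬ GrigorchukFamily.blockSequences.Countable ∧
      ∀ ω ∈ GrigorchukFamily.blockSequences,
        ∀ μ : MeasureTheory.ProbabilityMeasure (Subgroup (GrigorchukFamily.grigorchukGroup ω)),
          InvariantRandomSubgroup.IsIRS μ → InvariantRandomSubgroup.IsCosofic μ :=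
  ⟨GrigorchukFamily.not_countable_blockSequences, fun _ hω _ hμ =>
    GrigorchukFamily.isCosofic_of_isIRS
      (GrigorchukFamily.everyLetterOften_of_mem_blockSequences hω) hμ⟩
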